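/- Let $K$ be a field, let $S=K[x_1,\ldots,x_n]$ be the polynomial ring with its standard grading $\deg x_i=1$, and let $\mathfrak m=(x_1,\ldots,x_n)$. For a finitely generated nonzero $\mathbb Z$-graded $S$-module $N$, let $\operatorname{depth}(N)$ be the maximal length of an $N$-regular sequence contained in $\mathfrak m$. For a finitely generated nonzero $\mathbb Z$-graded $S$-module $M$, the Hilbert depth $\operatorname{hdepth}(M)$ is the maximal depth of a finitely generated $\mathbb Z$-graded $S$-module $N$ having the same Hilbert series as $M$, i.e. with $\dim_K N_d=\dim_K M_d$ for all $d\in\mathbb Z$. Theorem 2.2. Let $I\subset S$ be a monomial ideal (an ideal generated by monomials) with $0\neq I\neq S$. The following are equivalent: (1) $I$ is principal. (2) $\operatorname{hdepth}(I)=n$. (3) $\operatorname{hdepth}(S/I)=n-1$. Here $I$ and $S/I$ carry the gradings induced from $S$. -/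

import Mathlib

universe u

noncomputable section

namespace HilbertDepth

/-- The irrelevant maximal ideal `(x_1, …, x_n)` of `K[x_1, …, x_n]`. -/
def irrelevantIdeal (K : Type u) [Field K] (n : ℕ) : Ideal (MvPolynomial (Fin n) K) :=
  Ideal.span (Set.range MvPolynomial.X)

/-- The depth of a module over `K[x_1, …, x_n]`: the supremum of the lengths of the `N`-regular
sequences contained in `(x_1, …, x_n)`. (A regular sequence `f_1, …, f_r` also satisfies
`(f_1, …, f_r) N ≠ N`. For a nonzero finitely generated graded `N` the supremum is attained
and at most `n`.) -/
def depth (K : Type u) [Field K] (n : ℕ) (N : Type u) [AddCommGroup N]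
    [Module (MvPolynomial (Fin n) K) N] : ℕ∞ :=
  sSup {r : ℕ∞ | ∃ rs : List (MvPolynomial (Fin n) K),
    (∀ f ∈ rs, f ∈ irrelevantIdeal K n) ∧ RingTheory.Sequence.IsRegular N rs ∧
      r = (rs.length : ℕ∞)}

/-- `𝒩` is a `ℤ`-grading of the module `N` over the standard graded polynomial ring
`K[x_1, …, x_n]`: `N = ⨁_d N_d`, and `S_i N_d ⊆ N_{i+d}` for the space `S_i` of forms of
degree `i`. -/
structure IsGrading (K : Type u) [Field K] (n : ℕ) {N : Type u} [AddCommGroup N] [Module K N]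
    [Module (MvPolynomial (Fin n) K) N] (𝒩 : ℤ → Submodule K N) : Prop where
  isInternal : DirectSum.IsInternal 𝒩
  smul_mem : ∀ (i : ℕ) (d : ℤ) (f : MvPolynomial (Fin n) K) (x : N),
    f.IsHomogeneous i → x ∈ 𝒩 d → f • x ∈ 𝒩 ((i : ℤ) + d)

/-- The Hilbert series `∑_d (dim_K N_d) t^d` of a graded module, as its family of coefficients.
(The pieces of a finitely generated graded module are finite dimensional.) -/
def hilbertSeries (K : Type u) [Field K] {N : Type u} [AddCommGroup N] [Module K N]
    (𝒩 : ℤ → Submodule K N) : ℤ → ℕ :=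
  fun d => Module.finrank K (𝒩 d)

/-- The Hilbert depth of a module `M` over `K[x_1, …, x_n]` with grading `ℳ`: the maximal depth of
a finitely generated graded module with the same Hilbert series. (Every finitely generated module
is isomorphic to one in the universe of `K`.) -/
def hdepth (K : Type u) [Field K] (n : ℕ) {M : Type u} [AddCommGroup M] [Module K M]
    (ℳ : ℤ → Submodule K M) : ℕ∞ :=
  sSup {r : ℕ∞ | ∃ (N : Type u) (_ : AddCommGroup N) (_ : Module K N)
    (_ : Module (MvPolynomial (Fin n) K) N) (_ : IsScalarTower K (MvPolynomial (Fin n) K) N)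
    (𝒩 : ℤ → Submodule K N),
      Module.Finite (MvPolynomial (Fin n) K) N ∧ IsGrading K n 𝒩 ∧
      hilbertSeries K 𝒩 = hilbertSeries K ℳ ∧ r = depth K n N}

/-- A monomial ideal: an ideal generated by monomials. -/
def IsMonomialIdeal {K : Type u} [Field K] {n : ℕ} (I : Ideal (MvPolynomial (Fin n) K)) : Prop :=
  ∃ A : Set (Fin n →₀ ℕ), I = Ideal.span ((fun a => MvPolynomial.monomial a (1 : K)) '' A)

/-- The degree `d` piece of `S = K[x_1, …, x_n]`; it is zero for `d < 0`. -/
def polyPiece (K : Type u) [Field K] (n : ℕ) : ℤ → Submodule K (MvPolynomial (Fin n) K)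
  | Int.ofNat d => MvPolynomial.homogeneousSubmodule (Fin n) K d
  | Int.negSucc _ => ⊥

/-- The standard grading `I_d = I ∩ S_d` of a homogeneous ideal, as a module. -/
def idealGrading {K : Type u} [Field K] {n : ℕ} (I : Ideal (MvPolynomial (Fin n) K)) :
    ℤ → Submodule K I :=
  fun d => (polyPiece K n d).comap (I.subtype.restrictScalars K)

/-- The standard grading of `S ⧸ I`, for `I` a homogeneous ideal: its degree `d` piece is the
image of `S_d`. -/
def quotientGrading {K : Type u} [Field K] {n : ℕ} (I : Ideal (MvPolynomial (Fin n) K)) :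
    ℤ → Submodule K (MvPolynomial (Fin n) K ⧸ I) :=
  fun d => (polyPiece K n d).map (I.mkQ.restrictScalars K)

end HilbertDepth

end

/-! Write Δ for the backward difference, that is, multiplication of a Hilbert series by 1 - t. If N
has a regular sequence of length r in 𝔪, then Δ^r of its Hilbert function is nonnegative. The
sequence need not be homogeneous, so the proof goes through Ext: the sequence gives Ext^i(S/𝔪, N) =
0 for i < r, and over an infinite field (reached by flat base change) this vanishing provides a
linear nonzerodivisor l. The quotient N/lN has the differenced Hilbert function and one degree of
vanishing less. The outcome is `iterate_bwdDiff_nonneg_of_le_hdepth`, which reduces both converse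
implications to Hilbert functions.

Let h count the monomials in n variables and let H be the Hilbert function of I. If hdepth I = n,
then Δ^n H ≥ 0, so H is a sum of shifts of h. All shifts have the same leading growth and H ≤ h, so
there is only one, at the initial degree of I, and a form of that degree generates I. If hdepth S/I
= n - 1, let u be the gcd of the generators, of degree a. If u ∉ I, then Δ^(n-1)(h - H) ≥ 0 forces
H(d) ≤ h(d - a - 1). But I contains u(v, g) with v, g coprime of equal degree, so H(d) is at least
h(d - a) minus a second difference of h, which is of lower order than h(d - a) - h(d - a - 1). For
principal I = (g) with deg g = a, the modules S(-a) and S/(x_0^a) have the Hilbert functions of I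
and S/I; variables form the regular sequences, and a negative difference gives the upper bound. -/

/-! ### Ext vanishing and regular elements -/

open CategoryTheory Abelian RingTheory.Sequence in
/-- If `rs` is a weakly `M`-regular sequence in `I`, then `Ext^i(R/I, M) = 0` for `i < rs.length`. -/
lemma subsingleton_ext_quotient_of_isWeaklyRegular {R : Type u} [CommRing R] (I : Ideal R)
    (M : ModuleCat.{u} R) (rs : List R) (mem : ∀ r ∈ rs, r ∈ I) (reg : IsWeaklyRegular M rs) :
    ∀ i < rs.length, Subsingleton (Ext (ModuleCat.of R (R ⧸ I)) M i) := by
  induction rs generalizing M with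
  | nil => simp
  | cons a rs ih =>
    intro i hi
    rw [isWeaklyRegular_cons_iff] at reg
    simp only [List.mem_cons, forall_eq_or_imp] at mem
    have ha : a ∈ Module.annihilator R (R ⧸ I) := by
      rw [Ideal.annihilator_quotient]; exact mem.1
    match i with
    | 0 =>
      have : Subsingleton ((R ⧸ I) →ₗ[R] M) :=
        ⟨fun f g => LinearMap.ext fun x => reg.1 (by
          have hx : a • x = 0 := Module.mem_annihilator.mp ha x
          change a • f x = a • g x
          rw [← map_smul, ← map_smul, hx, map_zero, map_zero])⟩
      exact (Ext.addEquiv₀.trans ModuleCat.homAddEquiv).subsingleton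
    | i + 1 =>
      -- Multiplication by `a` on Ext^(i+1) is injective, because the preceding term Ext^i(R/I,
      -- M/aM) vanishes by induction; it is zero, because `a` kills R/I.
      let g := (AddCommGrpCat.ofHom ((Ext.mk₀ (ModuleCat.smulShortComplex M a).f).postcomp
        (ModuleCat.of R (R ⧸ I)) (add_zero (i + 1))))
      have mono_g : Mono g := by
        apply (Ext.covariant_sequence_exact₁' _ reg.1.smulShortComplex_shortExact i (i + 1)
          rfl).mono_g ((AddCommGrpCat.isZero_of_iff_subsingleton.mpr ?_).eq_zero_of_src _)
        exact ih (ModuleCat.of R (QuotSMulTop a M)) mem.2 reg.2 i (by simpa using hi)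
      have zero_g : g = 0 := Ext.postcomp_smul_id_eq_zero_of_mem_annihilator ha (i + 1)
      exact AddCommGrpCat.subsingleton_of_isZero (Limits.IsZero.of_mono_eq_zero _ zero_g)

-- Ext^i(L, M/xM) lies between Ext^i(L, M) and Ext^(i+1)(L, M). The element `x` need not come from
-- the sequence that produced the vanishing, so it may be chosen to be a linear form.
open CategoryTheory Abelian in
lemma subsingleton_ext_quotSMulTop {R : Type u} [CommRing R] (L M : ModuleCat.{u} R) {x : R}
    (hx : IsSMulRegular M x) {r : ℕ} (h_ext : ∀ i < r + 1, Subsingleton (Ext L M i)) :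
    ∀ i < r, Subsingleton (Ext L (ModuleCat.of R (QuotSMulTop x M)) i) := by
  intro i hi
  have zero1 := AddCommGrpCat.isZero_of_iff_subsingleton.mpr (h_ext i (by omega))
  have zero2 := AddCommGrpCat.isZero_of_iff_subsingleton.mpr (h_ext (i + 1) (by omega))
  exact AddCommGrpCat.subsingleton_of_isZero <| ShortComplex.Exact.isZero_of_both_zeros
    ((Ext.covariant_sequence_exact₃' L hx.smulShortComplex_shortExact) i (i + 1) rfl)
    (zero1.eq_zero_of_src _) (zero2.eq_zero_of_tgt _)

/-! ### Linear nonzerodivisors and differences of Hilbert functions -/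

namespace HilbertDepth

/-- The linear form `∑ c_i x_i`. -/
noncomputable def linearForm {K : Type u} [Field K] {n : ℕ} :
    (Fin n → K) →ₗ[K] MvPolynomial (Fin n) K :=
  Fintype.linearCombination K MvPolynomial.X

lemma linearForm_apply {K : Type u} [Field K] {n : ℕ} (c : Fin n → K) :
    linearForm c = ∑ i, c i • (MvPolynomial.X i : MvPolynomial (Fin n) K) := rfl

lemma linearForm_single {K : Type u} [Field K] {n : ℕ} (i : Fin n) :
    linearForm (Pi.single i (1 : K)) = MvPolynomial.X i := by
  simp [linearForm, Fintype.linearCombination_apply_single]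

/-- Over an infinite field, if no nonzero element is killed by `(x_1, …, x_n)`, some linear form
is a nonzerodivisor. -/
lemma exists_linearForm_isSMulRegular {K : Type u} [Field K] [Infinite K] {n : ℕ} {M : Type u}
    [AddCommGroup M] [Module (MvPolynomial (Fin n) K) M] [Module.Finite (MvPolynomial (Fin n) K) M]
    (h : Subsingleton
      ((MvPolynomial (Fin n) K ⧸ irrelevantIdeal K n) →ₗ[MvPolynomial (Fin n) K] M)) :
    ∃ c : Fin n → K, IsSMulRegular M (linearForm c) := by
  set S := MvPolynomial (Fin n) K
  have hfin := associatedPrimes.finite S M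
  let V : Ideal S → Subspace K (Fin n → K) := fun p => (p.restrictScalars K).comap linearForm
  -- An associated prime containing every linear form contains 𝔪, and S/𝔪 → S/p → M is then a
  -- nonzero map. So each `V p` is proper, and finitely many proper subspaces do not cover a space
  -- over an infinite field.
  have hV : ∀ p ∈ associatedPrimes S M, V p ≠ ⊤ := by
    intro p hp htop
    have hX : irrelevantIdeal K n ≤ p := by
      rw [irrelevantIdeal, Ideal.span_le]
      rintro _ ⟨i, rfl⟩
      have : Pi.single i (1 : K) ∈ V p := htop ▸ Submodule.mem_top
      simpa [V, linearForm_single] using this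
    obtain ⟨hprime, x, hx⟩ := (isAssociatedPrime_iff_exists_injective_linearMap p M).mp hp
    let f : (S ⧸ irrelevantIdeal K n) →ₗ[S] M := x ∘ₗ Submodule.factor hX
    have h1 : f = 0 := Subsingleton.elim _ _
    have h2 : f (Submodule.Quotient.mk 1) = 0 := by rw [h1]; rfl
    have h3 : (Submodule.Quotient.mk 1 : S ⧸ p) = 0 := hx (by rw [map_zero]; exact h2)
    rw [Submodule.Quotient.mk_eq_zero] at h3
    exact hprime.ne_top ((Ideal.eq_top_iff_one p).mpr h3)
  have hne := Subspace.biUnion_ne_univ_of_top_notMem (k := K) (E := Fin n → K)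
    (s := (hfin.image V).toFinset) (by
      simp only [Set.Finite.mem_toFinset, Set.mem_image, not_exists, not_and]
      exact hV)
  obtain ⟨c, hc⟩ := (Set.ne_univ_iff_exists_notMem _).mp hne
  refine ⟨c, ?_⟩
  have hc' : linearForm c ∉ ⋃ p ∈ associatedPrimes S M, (p : Set S) := by
    simp only [Set.mem_iUnion, not_exists] at hc ⊢
    intro p hp hmem
    exact hc (V p) (by simpa using ⟨p, hp, rfl⟩) hmem
  rw [biUnion_associatedPrimes_eq_zero_divisors] at hc'
  rw [isSMulRegular_iff_right_eq_zero_of_smul]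
  intro x hx
  by_contra hx0
  exact hc' ⟨x, hx0, hx⟩

/-- The backward difference `d ↦ h d - h (d - 1)`. -/
def bwdDiff (h : ℤ → ℤ) : ℤ → ℤ := fun d => h d - h (d - 1)

/-- If the idempotents `p`, `p'` on `M` satisfy `p L = L p'` for an injective `L`, the map induced by
`p` on the cokernel of `L` has rank `rank p - rank p'`. -/
lemma finrank_range_of_idempotent_cokernel {K M M₁ : Type*} [Field K] [AddCommGroup M] [Module K M]
    [AddCommGroup M₁] [Module K M₁] (L p p' : M →ₗ[K] M) (q : M₁ →ₗ[K] M₁) (π : M →ₗ[K] M₁)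
    (hπ : Function.Surjective π) (hker : LinearMap.ker π = LinearMap.range L)
    (hL : Function.Injective L) (hp : ∀ x, p (p x) = p x) (hpL : ∀ x, p (L x) = L (p' x))
    (hq : ∀ x, q (π x) = π (p x)) [FiniteDimensional K (LinearMap.range p)] :
    (Module.finrank K (LinearMap.range q) : ℤ) =
      Module.finrank K (LinearMap.range p) - Module.finrank K (LinearMap.range p') := by
  have h1 : LinearMap.range q = (LinearMap.range p).map π := by
    ext y
    constructor
    · rintro ⟨z, rfl⟩
      obtain ⟨x, rfl⟩ := hπ z
      exact ⟨p x, ⟨x, rfl⟩, (hq x).symm⟩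
    · rintro ⟨_, ⟨x, rfl⟩, rfl⟩
      exact ⟨π x, hq x⟩
  have h2 : LinearMap.ker π ⊓ LinearMap.range p = (LinearMap.range p').map L := by
    ext y
    rw [hker]
    constructor
    · rintro ⟨⟨x, rfl⟩, ⟨z, hz⟩⟩
      refine ⟨p' x, ⟨x, rfl⟩, ?_⟩
      rw [← hpL, ← hz, hp]
    · rintro ⟨_, ⟨x, rfl⟩, rfl⟩
      exact ⟨⟨_, rfl⟩, ⟨L x, hpL x⟩⟩
  have h3 := LinearMap.finrank_range_add_finrank_ker (π.domRestrict (LinearMap.range p))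
  have h4 : LinearMap.range (π.domRestrict (LinearMap.range p)) = (LinearMap.range p).map π :=
    LinearMap.range_domRestrict _ _
  have h5 : Module.finrank K (LinearMap.ker (π.domRestrict (LinearMap.range p))) =
      Module.finrank K (LinearMap.range p') := by
    have e1 : (LinearMap.ker (π.domRestrict (LinearMap.range p))).map
        (LinearMap.range p).subtype = LinearMap.ker π ⊓ LinearMap.range p := by
      rw [LinearMap.ker_domRestrict, Submodule.map_comap_subtype, inf_comm]
    rw [(Submodule.equivMapOfInjective _ (Submodule.subtype_injective _) _).finrank_eq, e1, h2,
      ← (Submodule.equivMapOfInjective L hL _).finrank_eq]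
  rw [h4, h5] at h3
  rw [h1]
  omega

/-- The graded projections are only K-linear, while `π` is a quotient by an R-submodule; a K-linear
section of `π` replaces the universal property. -/
lemma exists_linearMap_descend {K M M₁ : Type*} [Field K] [AddCommGroup M] [Module K M]
    [AddCommGroup M₁] [Module K M₁] (π : M →ₗ[K] M₁) (hπ : Function.Surjective π) (f : M →ₗ[K] M)
    (hf : ∀ x, π x = 0 → π (f x) = 0) : ∃ q : M₁ →ₗ[K] M₁, ∀ x, q (π x) = π (f x) := by
  obtain ⟨s, hs⟩ := π.exists_rightInverse_of_surjective (LinearMap.range_eq_top.mpr hπ)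
  refine ⟨π ∘ₗ f ∘ₗ s, fun x => ?_⟩
  have h1 : π (s (π x) - x) = 0 := by
    rw [map_sub, sub_eq_zero]
    exact LinearMap.congr_fun hs (π x)
  have h2 := hf _ h1
  rw [map_sub, map_sub, sub_eq_zero] at h2
  exact h2

open Pointwise in
lemma exists_linearMap_quotSMulTop (K : Type*) {R : Type*} (M : Type*) [Field K] [CommRing R]
    [Algebra K R] [AddCommGroup M] [Module K M] [Module R M] [IsScalarTower K R M] (l : R) :
    ∃ π : M →ₗ[K] QuotSMulTop l M, Function.Surjective π ∧ (∀ x, π x = 0 ↔ ∃ y, l • y = x) ∧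
      ∀ (s : R) x, s • π x = π (s • x) := by
  let π₀ : M →ₗ[R] QuotSMulTop l M := Submodule.mkQ _
  have h1 : Function.Surjective π₀ := Submodule.mkQ_surjective _
  have h2 : ∀ x, π₀ x = 0 ↔ ∃ y, l • y = x := fun x => by
    have : π₀ x = 0 ↔ x ∈ l • (⊤ : Submodule R M) := Submodule.Quotient.mk_eq_zero _
    rw [this, Submodule.mem_smul_pointwise_iff_exists]
    simp
  clear_value π₀
  exact ⟨π₀.restrictScalars K, h1, h2, fun s x => (map_smul π₀ s x).symm⟩

lemma smul_linearForm_comm {K : Type u} [Field K] {n : ℕ} {M : Type u} [AddCommGroup M]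
    [Module K M] [Module (MvPolynomial (Fin n) K) M] [IsScalarTower K (MvPolynomial (Fin n) K) M]
    (p p' : M →ₗ[K] M)
    (hX : ∀ i x, p ((MvPolynomial.X i : MvPolynomial (Fin n) K) • x) =
      (MvPolynomial.X i : MvPolynomial (Fin n) K) • p' x) (c : Fin n → K) (x : M) :
    p ((linearForm c : MvPolynomial (Fin n) K) • x) =
      (linearForm c : MvPolynomial (Fin n) K) • p' x := by
  simp only [linearForm_apply, Finset.sum_smul, map_sum, smul_assoc, map_smul, hX]

open CategoryTheory Abelian Pointwise in
/-- Over an infinite field, the vanishing of `Ext^i(K, M)` for `i < r` forces the `r`-th difference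
of the Hilbert function of `M` to be nonnegative. The grading of `M` enters through the projections
`p d` to its pieces. -/
lemma iterate_bwdDiff_nonneg_of_ext {K : Type u} [Field K] [Infinite K] {n : ℕ} (r : ℕ) {M : Type u}
    [AddCommGroup M] [Module K M] [Module (MvPolynomial (Fin n) K) M]
    [IsScalarTower K (MvPolynomial (Fin n) K) M] [Module.Finite (MvPolynomial (Fin n) K) M]
    (p : ℤ → M →ₗ[K] M) (hp : ∀ d x, p d (p d x) = p d x)
    (hX : ∀ d i x, p d ((MvPolynomial.X i : MvPolynomial (Fin n) K) • x) =
      (MvPolynomial.X i : MvPolynomial (Fin n) K) • p (d - 1) x)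
    (hfin : ∀ d, FiniteDimensional K (LinearMap.range (p d)))
    (hext : ∀ i < r, Subsingleton (Ext (ModuleCat.of (MvPolynomial (Fin n) K)
      (MvPolynomial (Fin n) K ⧸ irrelevantIdeal K n)) (ModuleCat.of (MvPolynomial (Fin n) K) M) i)) :
    ∀ d, 0 ≤ bwdDiff^[r] (fun d => (Module.finrank K (LinearMap.range (p d)) : ℤ)) d := by
  induction r generalizing M with
  | zero => intro d; simp
  | succ r ih =>
    have h0 : Subsingleton
        ((MvPolynomial (Fin n) K ⧸ irrelevantIdeal K n) →ₗ[MvPolynomial (Fin n) K] M) := by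
      have := hext 0 (by omega)
      exact ((Ext.addEquiv₀ (X := ModuleCat.of (MvPolynomial (Fin n) K)
        (MvPolynomial (Fin n) K ⧸ irrelevantIdeal K n)) (Y := ModuleCat.of _ M)).trans
          ModuleCat.homAddEquiv).symm.subsingleton
    -- Being homogeneous of degree one, `l` is compatible with the projections, so they descend to
    -- M/lM and the Hilbert function becomes its first difference.
    obtain ⟨c, hc⟩ := exists_linearForm_isSMulRegular h0
    set l : MvPolynomial (Fin n) K := linearForm c with hl
    have hpl : ∀ d x, p d (l • x) = l • p (d - 1) x := fun d x =>
      smul_linearForm_comm (p d) (p (d - 1)) (hX d) c x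
    obtain ⟨π, hπ, hker, hsm⟩ := exists_linearMap_quotSMulTop K M l
    let L : M →ₗ[K] M := Algebra.lsmul K K M l
    have hker : LinearMap.ker π = LinearMap.range L := by
      ext x
      exact hker x
    have hex : ∀ d, ∃ q : QuotSMulTop l M →ₗ[K] QuotSMulTop l M, ∀ x, q (π x) = π (p d x) := by
      refine fun d => exists_linearMap_descend π hπ (p d) fun x hx => ?_
      obtain ⟨y, rfl⟩ : x ∈ LinearMap.range L := hker ▸ hx
      have : l • p (d - 1) y ∈ LinearMap.ker π := by rw [hker]; exact ⟨_, rfl⟩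
      change π (p d (l • y)) = 0
      rw [hpl]
      exact this
    choose q hq using hex
    have key : bwdDiff (fun d => (Module.finrank K (LinearMap.range (p d)) : ℤ)) =
        fun d => (Module.finrank K (LinearMap.range (q d)) : ℤ) := by
      funext d
      exact (finrank_range_of_idempotent_cokernel L (p d) (p (d - 1)) (q d) π hπ hker hc (hp d)
        (hpl d) (hq d)).symm
    rw [Function.iterate_succ_apply, key]
    refine ih q ?_ ?_ ?_ ?_
    · intro d x
      obtain ⟨x, rfl⟩ := hπ x
      simp only [hq, hp]
    · intro d i x
      obtain ⟨x, rfl⟩ := hπ x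
      rw [hsm, hq, hq, hX, hsm]
    · intro d
      have : LinearMap.range (q d) ≤ (LinearMap.range (p d)).map π := by
        rintro _ ⟨x, rfl⟩
        obtain ⟨x, rfl⟩ := hπ x
        exact ⟨p d x, ⟨x, rfl⟩, (hq d x).symm⟩
      have := hfin d
      exact Submodule.finiteDimensional_of_le ‹_›
    · exact subsingleton_ext_quotSMulTop _ (ModuleCat.of _ M) hc hext

open TensorProduct in
lemma finrank_range_baseChange {K L V W : Type*} [Field K] [Field L] [Algebra K L] [AddCommGroup V]
    [Module K V] [AddCommGroup W] [Module K W] (f : V →ₗ[K] W) :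
    Module.finrank L (LinearMap.range (f.baseChange L)) = Module.finrank K (LinearMap.range f) := by
  have h1 : f.baseChange L = (LinearMap.range f).subtype.baseChange L ∘ₗ
      f.rangeRestrict.baseChange L := by
    rw [← LinearMap.baseChange_comp, LinearMap.subtype_comp_codRestrict]
  have h2 : Function.Surjective (f.rangeRestrict.baseChange L) :=
    LinearMap.lTensor_surjective L f.surjective_rangeRestrict
  have h3 : Function.Injective ((LinearMap.range f).subtype.baseChange L) :=
    Module.Flat.lTensor_preserves_injective_linearMap _ (Submodule.subtype_injective _)
  rw [h1, LinearMap.range_comp_of_range_eq_top _ (LinearMap.range_eq_top.mpr h2),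
    LinearMap.finrank_range_of_inj h3, Module.finrank_baseChange]

-- The isomorphism B ⊗_A M ≅ S ⊗_R M is given as S-linear; this records its compatibility with the
-- action of A, needed to multiply by the variables.
open TensorProduct in
lemma algebraMap_smul_cancelBaseChange_symm {R S A B M : Type*} [CommRing R] [CommRing S]
    [Algebra R S] [CommRing A] [CommRing B] [Algebra R A] [Algebra R B] [Algebra A B] [Algebra S B]
    [IsScalarTower R A B] [IsScalarTower R S B] [Algebra.IsPushout R S A B] [AddCommGroup M]
    [Module R M] [Module A M] [IsScalarTower R A M] (a : A) (y : S ⊗[R] M) :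
    algebraMap A B a • (Algebra.IsPushout.cancelBaseChange R S A B M).symm y =
      (Algebra.IsPushout.cancelBaseChange R S A B M).symm
        ((Algebra.lsmul R R M a).baseChange S y) := by
  induction y with
  | zero => simp
  | add y z hy hz => simp only [map_add, smul_add, hy, hz]
  | tmul s m =>
    simp only [Algebra.IsPushout.cancelBaseChange_symm_tmul, LinearMap.baseChange_tmul,
      Algebra.lsmul_coe, TensorProduct.smul_tmul', smul_eq_mul, TensorProduct.tmul_smul]
    rw [Algebra.smul_def]

attribute [local instance] MvPolynomial.algebraMvPolynomial in
open TensorProduct RingTheory.Sequence in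
/-- A weakly regular sequence of length at least `k` in `(x_1, …, x_n)` forces the `k`-th difference
of the Hilbert function to be nonnegative. -/
lemma iterate_bwdDiff_nonneg_of_isWeaklyRegular {K : Type u} [Field K] {n : ℕ} {N : Type u}
    [AddCommGroup N] [Module K N] [Module (MvPolynomial (Fin n) K) N]
    [IsScalarTower K (MvPolynomial (Fin n) K) N] [Module.Finite (MvPolynomial (Fin n) K) N]
    (p : ℤ → N →ₗ[K] N) (hp : ∀ d x, p d (p d x) = p d x)
    (hX : ∀ d i x, p d ((MvPolynomial.X i : MvPolynomial (Fin n) K) • x) =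
      (MvPolynomial.X i : MvPolynomial (Fin n) K) • p (d - 1) x)
    (hfin : ∀ d, FiniteDimensional K (LinearMap.range (p d)))
    (rs : List (MvPolynomial (Fin n) K)) (hmem : ∀ f ∈ rs, f ∈ irrelevantIdeal K n)
    (hreg : IsWeaklyRegular N rs) {k : ℕ} (hk : k ≤ rs.length) :
    ∀ d, 0 ≤ bwdDiff^[k] (fun d => (Module.finrank K (LinearMap.range (p d)) : ℤ)) d := by
  -- Only the infinitude of this extension is used.
  let L := AlgebraicClosure K
  let S := MvPolynomial (Fin n) K
  let B := MvPolynomial (Fin n) L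
  -- S → B is a base change of K → L, hence flat, so weak regularity of the sequence survives.
  have hflat : Module.Flat S B := Module.Flat.isBaseChange K S L B Algebra.IsPushout.out
  -- The left side carries the B-module structure, the right side the base-changed projections.
  let e : B ⊗[S] N ≃ₗ[L] L ⊗[K] N := Algebra.IsPushout.cancelBaseChange K L S B N
  have he : ∀ (a : S) y, algebraMap S B a • e.symm y =
      e.symm ((Algebra.lsmul K K N a).baseChange L y) := algebraMap_smul_cancelBaseChange_symm
  let q : ℤ → (B ⊗[S] N →ₗ[L] B ⊗[S] N) := fun d => e.symm.toLinearMap ∘ₗ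
    (p d).baseChange L ∘ₗ e.toLinearMap
  have hq : ∀ d y, q d (e.symm y) = e.symm ((p d).baseChange L y) := fun d y => by simp [q]
  have hrange : ∀ d, LinearMap.range (q d) =
      (LinearMap.range ((p d).baseChange L)).map e.symm.toLinearMap := fun d => by
    rw [← LinearMap.range_comp]
    exact LinearMap.range_comp_of_range_eq_top (e.symm.toLinearMap ∘ₗ (p d).baseChange L) e.range
  have hXmap : ∀ i, algebraMap S B (MvPolynomial.X i) = MvPolynomial.X i :=
    MvPolynomial.map_X (algebraMap K L)
  have hreg' : IsWeaklyRegular (B ⊗[S] N) (rs.map (algebraMap S B)) :=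
    hreg.of_flat_of_isBaseChange (TensorProduct.isBaseChange S N B)
  have hext := subsingleton_ext_quotient_of_isWeaklyRegular (irrelevantIdeal L n)
    (ModuleCat.of B (B ⊗[S] N)) (rs.map (algebraMap S B)) (by
      intro r hr
      obtain ⟨f, hf, rfl⟩ := List.mem_map.mp hr
      have h1 := Ideal.mem_map_of_mem (algebraMap S B) (hmem f hf)
      rw [irrelevantIdeal, Ideal.map_span] at h1
      refine Ideal.span_mono ?_ h1
      rintro _ ⟨_, ⟨i, rfl⟩, rfl⟩
      exact ⟨i, (hXmap i).symm⟩) hreg'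
  rw [List.length_map] at hext
  have key := iterate_bwdDiff_nonneg_of_ext (K := L) (n := n) k q ?_ ?_ ?_
    (fun i hi => hext i (by omega))
  · convert key using 4 with d d'
    rw [hrange, LinearEquiv.finrank_map_eq, finrank_range_baseChange]
  · intro d x
    obtain ⟨y, rfl⟩ := e.symm.surjective x
    rw [hq, hq, ← LinearMap.comp_apply, ← LinearMap.baseChange_comp]
    congr 3
    exact LinearMap.ext (hp d)
  · intro d i x
    obtain ⟨y, rfl⟩ := e.symm.surjective x
    rw [← hXmap, he, hq, hq, he, ← LinearMap.comp_apply, ← LinearMap.comp_apply,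
      ← LinearMap.baseChange_comp, ← LinearMap.baseChange_comp]
    congr 3
    exact LinearMap.ext (hX d i)
  · intro d
    rw [hrange]
    have : FiniteDimensional L (LinearMap.range ((p d).baseChange L)) := by
      have := hfin d
      have h1 : LinearMap.range ((p d).baseChange L) ≤
          LinearMap.range ((LinearMap.range (p d)).subtype.baseChange L) := by
        have : (p d).baseChange L = (LinearMap.range (p d)).subtype.baseChange L ∘ₗ
            (p d).rangeRestrict.baseChange L := by
          rw [← LinearMap.baseChange_comp, LinearMap.subtype_comp_codRestrict]
        rw [this]
        exact LinearMap.range_comp_le_range _ _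
      exact Submodule.finiteDimensional_of_le h1
    infer_instance

/-! ### Graded modules through their projections -/

/-- The projections to the pieces of an internal direct sum. -/
lemma exists_proj_of_isInternal {K N : Type*} [Field K] [AddCommGroup N] [Module K N]
    {𝒩 : ℤ → Submodule K N} (h : DirectSum.IsInternal 𝒩) :
    ∃ p : ℤ → N →ₗ[K] N, (∀ d x, p d x ∈ 𝒩 d) ∧ (∀ d, ∀ x ∈ 𝒩 d, p d x = x) ∧
      (∀ d e, e ≠ d → ∀ x ∈ 𝒩 e, p d x = 0) := by
  classical
  let _ : DirectSum.Decomposition 𝒩 := h.chooseDecomposition 𝒩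
  refine ⟨fun d => (𝒩 d).subtype ∘ₗ DirectSum.component K ℤ (fun i => 𝒩 i) d ∘ₗ
    (DirectSum.decomposeLinearEquiv 𝒩).toLinearMap, fun d x => ?_, fun d x hx => ?_,
    fun d e he x hx => ?_⟩
  · exact SetLike.coe_mem _
  · exact DirectSum.decompose_of_mem_same 𝒩 hx
  · exact DirectSum.decompose_of_mem_ne 𝒩 hx he

lemma isInternal_of_proj {K N : Type*} [Field K] [AddCommGroup N] [Module K N]
    {𝒩 : ℤ → Submodule K N} (p : ℤ → N →ₗ[K] N) (h1 : ∀ d, ∀ x ∈ 𝒩 d, p d x = x)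
    (h2 : ∀ d e, e ≠ d → ∀ x ∈ 𝒩 e, p d x = 0) (htop : ⨆ d, 𝒩 d = ⊤) :
    DirectSum.IsInternal 𝒩 := by
  classical
  rw [DirectSum.isInternal_submodule_iff_iSupIndep_and_iSup_eq_top]
  refine ⟨fun d => ?_, htop⟩
  rw [Submodule.disjoint_def]
  intro x hx hx'
  have hle : ⨆ j, ⨆ (_ : j ≠ d), 𝒩 j ≤ LinearMap.ker (p d) :=
    iSup₂_le fun j hj y hy => h2 d j hj y hy
  rw [← h1 d x hx]
  exact hle hx'

lemma linearMap_ext_of_iSup_eq_top {K N W : Type*} [Field K] [AddCommGroup N] [Module K N]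
    [AddCommGroup W] [Module K W] {𝒩 : ℤ → Submodule K N} (htop : ⨆ d, 𝒩 d = ⊤)
    (f g : N →ₗ[K] W) (h : ∀ d, ∀ x ∈ 𝒩 d, f x = g x) : f = g := by
  have : ⨆ d, 𝒩 d ≤ LinearMap.eqLocus f g := iSup_le fun d x hx => h d x hx
  rw [htop, top_le_iff, LinearMap.eqLocus_eq_top] at this
  exact this

section

variable {K : Type u} [Field K] {n : ℕ} {N : Type u} [AddCommGroup N] [Module K N]
  [Module (MvPolynomial (Fin n) K) N] [IsScalarTower K (MvPolynomial (Fin n) K) N]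
  {𝒩 : ℤ → Submodule K N}

lemma IsGrading.proj_smul (h : IsGrading K n 𝒩) {p : ℤ → N →ₗ[K] N}
    (h1 : ∀ d, ∀ x ∈ 𝒩 d, p d x = x) (h2 : ∀ d e, e ≠ d → ∀ x ∈ 𝒩 e, p d x = 0)
    {f : MvPolynomial (Fin n) K} {i : ℕ} (hf : f.IsHomogeneous i) (d : ℤ) (x : N) :
    p d (f • x) = f • p (d - i) x := by
  have : p d ∘ₗ Algebra.lsmul K K N f = Algebra.lsmul K K N f ∘ₗ p (d - i) := by
    refine linearMap_ext_of_iSup_eq_top h.isInternal.submodule_iSup_eq_top _ _ fun e x hx => ?_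
    simp only [LinearMap.comp_apply, Algebra.lsmul_coe]
    have hfx := h.smul_mem i e f x hf hx
    by_cases hed : e = d - i
    · rw [h1 (d - i) x (hed ▸ hx), h1 d (f • x) (by convert hfx using 2; omega)]
    · rw [h2 (d - i) e hed x hx, smul_zero, h2 d _ (by omega) _ hfx]
  exact LinearMap.congr_fun this x

/-- The pieces of a finitely generated graded module are finite dimensional. -/
lemma IsGrading.finiteDimensional (h : IsGrading K n 𝒩) [Module.Finite (MvPolynomial (Fin n) K) N]
    (d : ℤ) : FiniteDimensional K (𝒩 d) := by
  classical
  obtain ⟨p, h0, h1, h2⟩ := exists_proj_of_isInternal h.isInternal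
  obtain ⟨G, hG⟩ := (Module.Finite.fg_top : (⊤ : Submodule (MvPolynomial (Fin n) K) N).FG)
  have hfin : ∀ x : N, ∃ s : Finset ℤ, ∀ e ∉ s, p e x = 0 := by
    intro x
    have hx : x ∈ ⨆ d, 𝒩 d := h.isInternal.submodule_iSup_eq_top ▸ Submodule.mem_top
    obtain ⟨f, hf, rfl⟩ := (Submodule.mem_iSup_iff_exists_finsupp _ _).mp hx
    refine ⟨f.support, fun e he => ?_⟩
    rw [Finsupp.sum, map_sum]
    exact Finset.sum_eq_zero fun j hj => h2 e j (fun hje => he (hje ▸ hj)) _ (hf j)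
  choose s hs using hfin
  -- The sum of S_(d-e) · p_e(g) over generators g and the finitely many degrees e allowed by `s g`.
  -- For e > d, `toNat` gives S_0, which only enlarges W.
  let W : Submodule K N := G.sup fun g => (s g).sup fun e =>
    (MvPolynomial.homogeneousSubmodule (Fin n) K (d - e).toNat).map
      ((LinearMap.toSpanSingleton (MvPolynomial (Fin n) K) N (p e g)).restrictScalars K)
  have hW : FiniteDimensional K W := by
    have hfd : ∀ m, FiniteDimensional K (MvPolynomial.homogeneousSubmodule (Fin n) K m) :=
      fun m => Module.Finite.iff_fg.mpr (MvPolynomial.homogeneousSubmodule_fg _ _ m)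
    have := fun g => Submodule.finite_finset_sup (s g) fun e =>
      (MvPolynomial.homogeneousSubmodule (Fin n) K (d - e).toNat).map
      ((LinearMap.toSpanSingleton (MvPolynomial (Fin n) K) N (p e g)).restrictScalars K)
    exact Submodule.finite_finset_sup _ _
  have key : ∀ x, p d x ∈ W := by
    intro x
    have hx : x ∈ Submodule.span (MvPolynomial (Fin n) K) (G : Set N) := hG ▸ Submodule.mem_top
    induction hx using Submodule.closure_induction with
    | zero => simp
    | add x y _ _ hx hy => rw [map_add]; exact W.add_mem hx hy
    | smul_mem f g hg =>
      rw [← MvPolynomial.sum_homogeneousComponent f, Finset.sum_smul, map_sum]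
      refine W.sum_mem fun i _ => ?_
      have hi := MvPolynomial.homogeneousComponent_isHomogeneous i f
      rw [h.proj_smul h1 h2 hi]
      by_cases hmem : d - i ∈ s g
      · have hle : (MvPolynomial.homogeneousSubmodule (Fin n) K (d - (d - i : ℤ)).toNat).map
            ((LinearMap.toSpanSingleton (MvPolynomial (Fin n) K) N
              (p (d - i) g)).restrictScalars K) ≤ W :=
          le_trans (Finset.le_sup (f := fun e => (MvPolynomial.homogeneousSubmodule (Fin n) K
            (d - e).toNat).map ((LinearMap.toSpanSingleton (MvPolynomial (Fin n) K) N
              (p e g)).restrictScalars K)) hmem) (Finset.le_sup (f := fun g => (s g).sup fun e =>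
                (MvPolynomial.homogeneousSubmodule (Fin n) K (d - e).toNat).map
                ((LinearMap.toSpanSingleton (MvPolynomial (Fin n) K) N
                  (p e g)).restrictScalars K)) (Finset.mem_coe.mp hg))
        refine hle ⟨MvPolynomial.homogeneousComponent i f, ?_, rfl⟩
        rw [sub_sub_cancel, Int.toNat_natCast]
        exact hi
      · rw [hs g _ hmem, smul_zero]
        exact W.zero_mem
  refine Submodule.finiteDimensional_of_le (S₂ := W) fun x hx => ?_
  rw [← h1 d x hx]
  exact key x

open RingTheory.Sequence in
lemma IsGrading.iterate_bwdDiff_nonneg (h : IsGrading K n 𝒩)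
    [Module.Finite (MvPolynomial (Fin n) K) N] (rs : List (MvPolynomial (Fin n) K))
    (hmem : ∀ f ∈ rs, f ∈ irrelevantIdeal K n) (hreg : IsWeaklyRegular N rs) {k : ℕ}
    (hk : k ≤ rs.length) (d : ℤ) : 0 ≤ bwdDiff^[k] (fun d => (hilbertSeries K 𝒩 d : ℤ)) d := by
  obtain ⟨p, h0, h1, h2⟩ := exists_proj_of_isInternal h.isInternal
  have hr : ∀ d, LinearMap.range (p d) = 𝒩 d := fun d =>
    le_antisymm (by rintro _ ⟨x, rfl⟩; exact h0 d x) fun x hx => ⟨x, h1 d x hx⟩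
  have key := iterate_bwdDiff_nonneg_of_isWeaklyRegular p (fun d x => h1 d _ (h0 d x))
    (fun d i x => by exact_mod_cast h.proj_smul h1 h2 (MvPolynomial.isHomogeneous_X K i) d x)
    (fun d => by rw [hr]; exact h.finiteDimensional d) rs hmem hreg hk d
  have hrank : ∀ d, Module.finrank K (LinearMap.range (p d)) = Module.finrank K (𝒩 d) :=
    fun d => by rw [hr]
  simp only [hrank] at key
  exact key

end

/-! ### Hilbert depth bounds -/

section

variable {K : Type u} [Field K] {n : ℕ} {M : Type u} [AddCommGroup M] [Module K M]
  {ℳ : ℤ → Submodule K M}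

/-- The Hilbert depth bounds the order of the differences of the Hilbert function that are known to
be nonnegative. -/
lemma iterate_bwdDiff_nonneg_of_le_hdepth {k : ℕ} (h : (k : ℕ∞) ≤ hdepth K n ℳ) (d : ℤ) :
    0 ≤ bwdDiff^[k] (fun d => (hilbertSeries K ℳ d : ℤ)) d := by
  cases k with
  | zero => simp
  | succ m =>
    -- The strict inequality with `m` avoids having to know that the two suprema are attained.
    have h1 : (m : ℕ∞) < hdepth K n ℳ := lt_of_lt_of_le (by exact_mod_cast m.lt_succ_self) h
    obtain ⟨_, ⟨N, _, _, _, _, 𝒩, hfin, hgr, hser, rfl⟩, h2⟩ := lt_sSup_iff.mp h1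
    obtain ⟨_, ⟨rs, hmem, hreg, rfl⟩, h3⟩ := lt_sSup_iff.mp h2
    rw [← hser]
    exact hgr.iterate_bwdDiff_nonneg rs hmem hreg.toIsWeaklyRegular
      (by exact_mod_cast h3) d

lemma hdepth_le_of_iterate_bwdDiff_neg {k : ℕ} {d : ℤ}
    (h : bwdDiff^[k + 1] (fun d => (hilbertSeries K ℳ d : ℤ)) d < 0) :
    hdepth K n ℳ ≤ k := by
  by_contra! hlt
  have := iterate_bwdDiff_nonneg_of_le_hdepth (k := k + 1)
    (by exact_mod_cast Order.add_one_le_of_lt hlt) d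
  omega

lemma le_hdepth {N : Type u} [AddCommGroup N] [Module K N] [Module (MvPolynomial (Fin n) K) N]
    [IsScalarTower K (MvPolynomial (Fin n) K) N] [Module.Finite (MvPolynomial (Fin n) K) N]
    {𝒩 : ℤ → Submodule K N} (h : IsGrading K n 𝒩)
    (hser : hilbertSeries K 𝒩 = hilbertSeries K ℳ) (rs : List (MvPolynomial (Fin n) K))
    (hmem : ∀ f ∈ rs, f ∈ irrelevantIdeal K n) (hreg : RingTheory.Sequence.IsRegular N rs) :
    (rs.length : ℕ∞) ≤ hdepth K n ℳ :=
  le_trans (b := depth K n N) (le_sSup ⟨rs, hmem, hreg, rfl⟩)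
    (le_sSup ⟨N, _, _, _, ‹_›, 𝒩, ‹_›, h, hser, rfl⟩)

end

/-! ### Calculus of backward differences -/

/-- The shift `d ↦ h (d - a)`. -/
def shift (a : ℤ) (h : ℤ → ℤ) : ℤ → ℤ := fun d => h (d - a)

lemma bwdDiff_sub (f g : ℤ → ℤ) : bwdDiff (f - g) = bwdDiff f - bwdDiff g := by
  funext d; simp only [bwdDiff, Pi.sub_apply]; ring

lemma iterate_bwdDiff_sub (k : ℕ) (f g : ℤ → ℤ) :
    bwdDiff^[k] (f - g) = bwdDiff^[k] f - bwdDiff^[k] g := by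
  induction k generalizing f g with
  | zero => rfl
  | succ k ih => simp only [Function.iterate_succ_apply, bwdDiff_sub, ih]

lemma iterate_bwdDiff_shift (k : ℕ) (a : ℤ) (f : ℤ → ℤ) :
    bwdDiff^[k] (shift a f) = shift a (bwdDiff^[k] f) := by
  induction k generalizing f with
  | zero => rfl
  | succ k ih =>
    rw [Function.iterate_succ_apply, Function.iterate_succ_apply, ← ih]
    congr 1
    funext d
    simp only [bwdDiff, shift]
    rw [sub_right_comm]

lemma bwdDiff_eq_zero_of_le {f : ℤ → ℤ} {a : ℤ} (h : ∀ d ≤ a, f d = 0) :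
    ∀ d ≤ a, bwdDiff f d = 0 := fun d hd => by
  rw [bwdDiff, h d hd, h (d - 1) (by omega), sub_zero]

lemma iterate_bwdDiff_eq_zero_of_le {f : ℤ → ℤ} {a : ℤ} (k : ℕ) (h : ∀ d ≤ a, f d = 0) :
    ∀ d ≤ a, bwdDiff^[k] f d = 0 := by
  induction k generalizing f with
  | zero => exact h
  | succ k ih => exact ih (bwdDiff_eq_zero_of_le h)

/-- Multiplying a series by (1 - t)^k does not change its lowest term. -/
lemma iterate_bwdDiff_apply_of_lt {f : ℤ → ℤ} {a : ℤ} (k : ℕ) (h : ∀ d < a, f d = 0) :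
    bwdDiff^[k] f a = f a := by
  induction k generalizing f with
  | zero => rfl
  | succ k ih =>
    have h' : ∀ d ≤ a - 1, f d = 0 := fun d hd => h d (by omega)
    rw [Function.iterate_succ_apply, ih fun d hd => bwdDiff_eq_zero_of_le h' d (by omega), bwdDiff,
      h' _ le_rfl, sub_zero]

lemma nonneg_of_bwdDiff_nonneg {f : ℤ → ℤ} {a : ℤ} (h : ∀ d ≤ a, f d = 0)
    (hd : ∀ d, 0 ≤ bwdDiff f d) (d : ℤ) : 0 ≤ f d := by
  rcases le_total d a with hda | hda
  · exact (h d hda).ge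
  · induction d, hda using Int.leInduction with
    | base => exact (h a le_rfl).ge
    | succ e _ ih =>
      have := hd (e + 1)
      rw [bwdDiff, add_sub_cancel_right] at this
      omega

/-- Dividing a series bounded below by (1 - t)^k amounts to repeated summation, which preserves
nonnegative coefficients. -/
lemma nonneg_of_iterate_bwdDiff_nonneg {f : ℤ → ℤ} {a : ℤ} (k : ℕ) (h : ∀ d ≤ a, f d = 0)
    (hd : ∀ d, 0 ≤ bwdDiff^[k] f d) (d : ℤ) : 0 ≤ f d := by
  induction k generalizing f d with
  | zero => exact hd d
  | succ k ih => exact nonneg_of_bwdDiff_nonneg h (ih (bwdDiff_eq_zero_of_le h) hd) d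

/-! ### Growth of the Hilbert function of the polynomial ring -/

/-- The number of monomials of degree `d` in `k + 1` variables. -/
def monomialCount (k : ℕ) (d : ℤ) : ℤ := if d < 0 then 0 else (d.toNat + k).choose k

lemma monomialCount_of_neg (k : ℕ) {d : ℤ} (h : d < 0) : monomialCount k d = 0 := if_pos h

lemma monomialCount_natCast (k m : ℕ) : monomialCount k m = (m + k).choose k := by
  simp [monomialCount]

lemma monomialCount_nonneg (k : ℕ) (d : ℤ) : 0 ≤ monomialCount k d := by
  unfold monomialCount; split_ifs <;> positivity

lemma bwdDiff_monomialCount_succ (k : ℕ) :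
    bwdDiff (monomialCount (k + 1)) = monomialCount k := by
  funext d
  rcases lt_or_ge d 0 with hd | hd
  · simp only [bwdDiff, monomialCount_of_neg _ hd, monomialCount_of_neg _ (show d - 1 < 0 by omega),
      sub_zero]
  · obtain ⟨m, rfl⟩ := Int.eq_ofNat_of_zero_le hd
    cases m with
    | zero => simp [bwdDiff, monomialCount]
    | succ m =>
      have h1 : ((m + 1 : ℕ) : ℤ) - 1 = (m : ℕ) := by push_cast; ring
      rw [bwdDiff, h1, monomialCount_natCast, monomialCount_natCast, monomialCount_natCast,
        show m + 1 + (k + 1) = (m + 1 + k) + 1 by ring, Nat.choose_succ_succ,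
        show m + (k + 1) = m + 1 + k by ring]
      push_cast
      ring

lemma monomialCount_zero (d : ℤ) : monomialCount 0 d = if d < 0 then 0 else 1 := by
  simp [monomialCount]

lemma bwdDiff_monomialCount_zero (d : ℤ) :
    bwdDiff (monomialCount 0) d = if d = 0 then 1 else 0 := by
  simp only [bwdDiff, monomialCount_zero]
  split_ifs <;> omega

lemma iterate_bwdDiff_monomialCount (k : ℕ) : bwdDiff^[k] (monomialCount k) = monomialCount 0 := by
  induction k with
  | zero => rfl
  | succ k ih => rw [Function.iterate_succ_apply, bwdDiff_monomialCount_succ, ih]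

lemma iterate_succ_bwdDiff_monomialCount (k : ℕ) (d : ℤ) :
    bwdDiff^[k + 1] (monomialCount k) d = if d = 0 then 1 else 0 := by
  rw [Function.iterate_succ_apply', iterate_bwdDiff_monomialCount, bwdDiff_monomialCount_zero]

lemma monomialCount_mono (k : ℕ) : Monotone (monomialCount k) := by
  refine monotone_int_of_le_succ fun d => ?_
  have h : 0 ≤ bwdDiff (monomialCount k) (d + 1) := by
    cases k with
    | zero => rw [bwdDiff_monomialCount_zero]; split_ifs <;> omega
    | succ k => rw [bwdDiff_monomialCount_succ]; exact monomialCount_nonneg _ _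
  rw [bwdDiff, add_sub_cancel_right] at h
  omega

/-- Telescoping into `c` first differences, each at most `monomialCount k d` by monotonicity. -/
lemma monomialCount_sub_le (k c : ℕ) (d : ℤ) :
    monomialCount (k + 1) d - monomialCount (k + 1) (d - c) ≤ c * monomialCount k d := by
  induction c with
  | zero => simp
  | succ c ih =>
    have h1 := congrFun (bwdDiff_monomialCount_succ k) (d - c)
    have h2 := monomialCount_mono k (show d - c ≤ d by omega)
    rw [bwdDiff] at h1
    push_cast
    rw [← sub_sub, add_mul]
    linarith

/-- The leading term dominates: differences of `monomialCount` are of lower order. -/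
lemma eventually_mul_sub_lt_monomialCount (k m c : ℕ) :
    ∃ d₀ : ℤ, ∀ d ≥ d₀, m * (monomialCount k d - monomialCount k (d - c)) < monomialCount k d := by
  cases k with
  | zero =>
    refine ⟨c, fun d hd => ?_⟩
    rw [monomialCount_zero, monomialCount_zero, if_neg (by omega), if_neg (by omega)]
    simp
  | succ k =>
    -- The left side is at most m c h_k(d), and (k+1) h_(k+1)(d) = (d+k+1) h_k(d), so m c (k+1) <
    -- d+k+1 suffices.
    refine ⟨m * c * (k + 1), fun d hd => ?_⟩
    have hd0 : 0 ≤ d := le_trans (by positivity) hd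
    have h1 : (k + 1) * monomialCount (k + 1) d = (d + k + 1) * monomialCount k d := by
      obtain ⟨e, rfl⟩ := Int.eq_ofNat_of_zero_le hd0
      rw [monomialCount_natCast, monomialCount_natCast]
      have := Nat.add_one_mul_choose_eq (e + k) k
      rw [show e + (k + 1) = e + k + 1 by ring]
      have h := congrArg (Nat.cast : ℕ → ℤ) this
      push_cast at h
      linarith
    have h2 : 0 < monomialCount k d := by
      obtain ⟨e, rfl⟩ := Int.eq_ofNat_of_zero_le hd0
      rw [monomialCount_natCast]
      exact_mod_cast Nat.choose_pos (by omega)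
    have h3 := monomialCount_sub_le k c d
    have h4 : (m : ℤ) * (monomialCount (k + 1) d - monomialCount (k + 1) (d - c)) ≤
        m * (c * monomialCount k d) := mul_le_mul_of_nonneg_left h3 (by positivity)
    have h5 : (k + 1 : ℤ) * (m * (c * monomialCount k d)) < (k + 1) * monomialCount (k + 1) d := by
      rw [h1]
      have : (m * c * (k + 1) : ℤ) * monomialCount k d < (d + k + 1) * monomialCount k d :=
        mul_lt_mul_of_pos_right (by linarith) h2
      linarith
    exact lt_of_le_of_lt h4 (lt_of_mul_lt_mul_left h5 (by positivity))

/-- `h(d) - 2 h(d - D) + h(d - 2D)` has lower order than the first difference of `h`. -/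
lemma monomialCount_second_difference_le (k D : ℕ) (d : ℤ) :
    monomialCount (k + 1) d - 2 * monomialCount (k + 1) (d - D) +
      monomialCount (k + 1) (d - 2 * D) ≤
      D * (monomialCount k d - monomialCount k (d - (2 * D : ℕ))) := by
  -- Telescoping in `c` gives terms h_k(d-j) - h_k(d-D-j) with j < D, each at most h_k(d) -
  -- h_k(d-2D).
  have key : ∀ c : ℕ, c ≤ D → (monomialCount (k + 1) d - monomialCount (k + 1) (d - c)) -
      (monomialCount (k + 1) (d - D) - monomialCount (k + 1) (d - D - c)) ≤
      c * (monomialCount k d - monomialCount k (d - (2 * D : ℕ))) := by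
    intro c
    induction c with
    | zero => simp
    | succ c ih =>
      intro hc
      have ih := ih (by omega)
      have h1 := congrFun (bwdDiff_monomialCount_succ k) (d - c)
      have h2 := congrFun (bwdDiff_monomialCount_succ k) (d - D - c)
      have h3 := monomialCount_mono k (show d - c ≤ d by omega)
      have h4 := monomialCount_mono k (show d - (2 * D : ℕ) ≤ d - D - c by push_cast; omega)
      rw [bwdDiff] at h1 h2
      push_cast at ih h4 ⊢
      rw [← sub_sub, ← sub_sub, add_mul]
      linarith
  have := key D le_rfl
  rw [show d - D - D = d - 2 * D by ring] at this
  linarith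

/-! ### Graded pieces of S, of ideals and of quotients -/

open MvPolynomial

section

variable {K : Type u} [Field K] {n : ℕ}

lemma polyPiece_natCast (m : ℕ) : polyPiece K n (m : ℤ) = homogeneousSubmodule (Fin n) K m := rfl

lemma polyPiece_of_neg {d : ℤ} (h : d < 0) : polyPiece K n d = ⊥ := by
  obtain ⟨m, rfl⟩ := Int.eq_negSucc_of_lt_zero h
  rfl

instance finiteDimensional_polyPiece (d : ℤ) : FiniteDimensional K (polyPiece K n d) := by
  rcases lt_or_ge d 0 with hd | hd
  · rw [polyPiece_of_neg hd]; infer_instance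
  · obtain ⟨m, rfl⟩ := Int.eq_ofNat_of_zero_le hd
    exact Module.Finite.iff_fg.mpr (homogeneousSubmodule_fg _ _ m)

/-- The projection of a polynomial to its homogeneous part of degree `d`. -/
noncomputable def polyProj (K : Type u) [Field K] (n : ℕ) (d : ℤ) :
    MvPolynomial (Fin n) K →ₗ[K] MvPolynomial (Fin n) K :=
  if d < 0 then 0 else homogeneousComponent d.toNat

lemma polyProj_of_mem (d : ℤ) (f : MvPolynomial (Fin n) K) (hf : f ∈ polyPiece K n d) :
    polyProj K n d f = f := by
  rcases lt_or_ge d 0 with hd | hd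
  · rw [polyPiece_of_neg hd, Submodule.mem_bot] at hf
    rw [hf, map_zero]
  · obtain ⟨m, rfl⟩ := Int.eq_ofNat_of_zero_le hd
    rw [polyProj, if_neg (by omega), Int.toNat_natCast, homogeneousComponent_of_mem hf, if_pos rfl]

lemma polyProj_of_mem_ne (d e : ℤ) (hed : e ≠ d) (f : MvPolynomial (Fin n) K)
    (hf : f ∈ polyPiece K n e) : polyProj K n d f = 0 := by
  rcases lt_or_ge e 0 with he | he
  · rw [polyPiece_of_neg he, Submodule.mem_bot] at hf
    rw [hf, map_zero]
  · obtain ⟨m, rfl⟩ := Int.eq_ofNat_of_zero_le he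
    rw [polyProj]
    split_ifs with hd
    · rfl
    · rw [homogeneousComponent_of_mem hf, if_neg (by omega)]

lemma polyProj_mem (d : ℤ) (f : MvPolynomial (Fin n) K) : polyProj K n d f ∈ polyPiece K n d := by
  rcases lt_or_ge d 0 with hd | hd
  · rw [polyProj, if_pos hd]; exact Submodule.zero_mem _
  · obtain ⟨m, rfl⟩ := Int.eq_ofNat_of_zero_le hd
    rw [polyProj, if_neg (by omega)]
    exact homogeneousComponent_isHomogeneous _ _

lemma sum_polyProj (f : MvPolynomial (Fin n) K) :
    ∑ i ∈ Finset.range (f.totalDegree + 1), polyProj K n i f = f := by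
  conv_rhs => rw [← sum_homogeneousComponent f]
  refine Finset.sum_congr rfl fun i _ => ?_
  rw [polyProj, if_neg (by omega), Int.toNat_natCast]

lemma iSup_polyPiece : ⨆ d, polyPiece K n d = ⊤ := by
  rw [eq_top_iff]
  intro f _
  rw [← sum_polyProj f]
  exact Submodule.sum_mem _ fun i _ => Submodule.mem_iSup_of_mem (i : ℤ) (polyProj_mem _ _)

lemma mul_mem_polyPiece (i : ℕ) (d : ℤ) (f x : MvPolynomial (Fin n) K) (hf : f.IsHomogeneous i)
    (hx : x ∈ polyPiece K n d) : f * x ∈ polyPiece K n (i + d) := by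
  rcases lt_or_ge d 0 with hd | hd
  · rw [polyPiece_of_neg hd, Submodule.mem_bot] at hx
    rw [hx, mul_zero]
    exact Submodule.zero_mem _
  · obtain ⟨m, rfl⟩ := Int.eq_ofNat_of_zero_le hd
    exact hf.mul hx

/-- The grading of `S` shifted by `a`. -/
lemma isGrading_polyPiece (a : ℤ) : IsGrading K n (fun d => polyPiece K n (d - a)) where
  isInternal := by
    refine isInternal_of_proj (fun d => polyProj K n (d - a))
      (fun d x hx => polyProj_of_mem _ x hx)
      (fun d e he x hx => polyProj_of_mem_ne _ _ (by omega) x hx) ?_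
    rw [← iSup_polyPiece]
    exact (Equiv.subRight a).iSup_comp (g := polyPiece K n)
  smul_mem i d f x hf hx := by
    have h := mul_mem_polyPiece i (d - a) f x hf hx
    rwa [← add_sub_assoc] at h

lemma polyProj_mul {f : MvPolynomial (Fin n) K} {i : ℕ} (hf : f.IsHomogeneous i) (d : ℤ)
    (x : MvPolynomial (Fin n) K) : polyProj K n d (f * x) = f * polyProj K n (d - i) x := by
  have h := isGrading_polyPiece (K := K) (n := n) 0
  simp only [sub_zero] at h
  exact h.proj_smul polyProj_of_mem polyProj_of_mem_ne hf d x

lemma finrank_polyPiece (k : ℕ) (d : ℤ) :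
    (Module.finrank K (polyPiece K (k + 1) d) : ℤ) = monomialCount k d := by
  rcases lt_or_ge d 0 with hd | hd
  · rw [polyPiece_of_neg hd, monomialCount_of_neg _ hd, finrank_bot, Nat.cast_zero]
  · obtain ⟨m, rfl⟩ := Int.eq_ofNat_of_zero_le hd
    rw [polyPiece_natCast, monomialCount_natCast]
    let T := (Finset.univ : Finset (Fin (k + 1))).finsuppAntidiag m
    have hT : ∀ α : Fin (k + 1) →₀ ℕ, α ∈ T ↔ α.degree = m := fun α => by
      rw [Finset.mem_finsuppAntidiag, Finsupp.degree_eq_sum]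
      simp
    have h1 : homogeneousSubmodule (Fin (k + 1)) K m =
        Submodule.span K (Set.range fun α : T => (basisMonomials (Fin (k + 1)) K) α) := by
      rw [homogeneousSubmodule_eq_finsupp_supported, AddMonoidAlgebra.supported_eq_span_single]
      congr 1
      ext f
      simp [hT, single_eq_monomial]
    have h2 : LinearIndependent K fun α : T => (basisMonomials (Fin (k + 1)) K) α :=
      (basisMonomials (Fin (k + 1)) K).linearIndependent.comp _ Subtype.val_injective
    rw [h1, finrank_span_eq_card h2, Fintype.card_coe, Finset.card_finsuppAntidiag_nat_eq_choose,
      Finset.card_univ, Fintype.card_fin, show k + 1 + m - 1 = m + k by omega,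
      Nat.choose_symm_add]

/-- The degree `d` piece `I ∩ S_d` of an ideal, as a subspace of `S`. -/
noncomputable def idealPiece (I : Ideal (MvPolynomial (Fin n) K)) (d : ℤ) :
    Submodule K (MvPolynomial (Fin n) K) := I.restrictScalars K ⊓ polyPiece K n d

lemma idealPiece_le (I : Ideal (MvPolynomial (Fin n) K)) (d : ℤ) :
    idealPiece I d ≤ polyPiece K n d := inf_le_right

instance finiteDimensional_idealPiece (I : Ideal (MvPolynomial (Fin n) K)) (d : ℤ) :
    FiniteDimensional K (idealPiece I d) := Submodule.finiteDimensional_of_le (idealPiece_le I d)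

lemma idealPiece_mono {I J : Ideal (MvPolynomial (Fin n) K)} (h : I ≤ J) (d : ℤ) :
    idealPiece I d ≤ idealPiece J d := inf_le_inf_right _ h

lemma hilbertSeries_idealGrading (I : Ideal (MvPolynomial (Fin n) K)) (d : ℤ) :
    hilbertSeries K (idealGrading I) d = Module.finrank K (idealPiece I d) := by
  have h : idealPiece I d = (idealGrading I d).map (I.subtype.restrictScalars K) := by
    rw [idealGrading, Submodule.map_comap_eq, idealPiece]
    congr 1
    ext f
    simp
  rw [h, ← (Submodule.equivMapOfInjective (I.subtype.restrictScalars K)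
    (Submodule.subtype_injective I) _).finrank_eq]
  rfl

lemma hilbertSeries_quotientGrading (I : Ideal (MvPolynomial (Fin n) K)) (d : ℤ) :
    (hilbertSeries K (quotientGrading I) d : ℤ) =
      Module.finrank K (polyPiece K n d) - Module.finrank K (idealPiece I d) := by
  have h1 := LinearMap.finrank_range_add_finrank_ker
    ((I.mkQ.restrictScalars K).domRestrict (polyPiece K n d))
  have h2 : (LinearMap.ker ((I.mkQ.restrictScalars K).domRestrict (polyPiece K n d))).map
      (polyPiece K n d).subtype = idealPiece I d := by
    rw [LinearMap.ker_domRestrict, Submodule.map_comap_subtype, idealPiece, inf_comm]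
    congr 1
    ext f
    simp
  rw [(Submodule.equivMapOfInjective _ (Submodule.subtype_injective _) _).finrank_eq, h2,
    LinearMap.range_domRestrict] at h1
  rw [hilbertSeries, quotientGrading]
  omega

lemma mem_of_forall_polyProj_mem {J : Ideal (MvPolynomial (Fin n) K)} {f : MvPolynomial (Fin n) K}
    (h : ∀ d, polyProj K n d f ∈ J) : f ∈ J := by
  rw [← sum_polyProj f]
  exact J.sum_mem fun i _ => h i

/-- A homogeneous ideal is determined by its Hilbert function among the ideals containing a given
one. -/
lemma le_of_finrank_idealPiece_le {I J : Ideal (MvPolynomial (Fin n) K)} (hJI : J ≤ I)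
    (hI : ∀ f ∈ I, ∀ d, polyProj K n d f ∈ I)
    (h : ∀ d, Module.finrank K (idealPiece I d) ≤ Module.finrank K (idealPiece J d)) : I ≤ J := by
  intro f hf
  refine mem_of_forall_polyProj_mem fun d => ?_
  have h1 : idealPiece J d = idealPiece I d :=
    Submodule.eq_of_le_of_finrank_le (idealPiece_mono hJI d) (h d)
  have h2 : polyProj K n d f ∈ idealPiece J d := h1 ▸ ⟨hI f hf d, polyProj_mem d f⟩
  exact h2.1

lemma IsMonomialIdeal.polyProj_mem {I : Ideal (MvPolynomial (Fin n) K)} (hI : IsMonomialIdeal I)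
    {f : MvPolynomial (Fin n) K} (hf : f ∈ I) (d : ℤ) : polyProj K n d f ∈ I := by
  obtain ⟨A, rfl⟩ := hI
  rw [polyProj]
  split_ifs
  · exact Submodule.zero_mem _
  · rw [mem_ideal_span_monomial_image] at hf ⊢
    intro α hα
    refine hf α ?_
    rw [mem_support_iff, coeff_homogeneousComponent] at hα
    rw [mem_support_iff]
    intro h0
    simp [h0] at hα

/-- If g x has degree d, projecting to degree d replaces x by its part of degree d - a without
changing g x. -/
lemma idealPiece_span_singleton {g : MvPolynomial (Fin n) K} {a : ℕ} (hg : g.IsHomogeneous a)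
    (d : ℤ) : idealPiece (Ideal.span {g}) d =
      (polyPiece K n (d - a)).map (LinearMap.mulLeft K g) := by
  ext f
  constructor
  · rintro ⟨h1, h2⟩
    obtain ⟨x, rfl⟩ := Ideal.mem_span_singleton.mp h1
    refine ⟨polyProj K n (d - a) x, HilbertDepth.polyProj_mem _ _, ?_⟩
    rw [LinearMap.mulLeft_apply, ← polyProj_mul hg, polyProj_of_mem d _ h2]
  · rintro ⟨x, hx, rfl⟩
    refine ⟨Ideal.mem_span_singleton.mpr ⟨x, rfl⟩, ?_⟩
    have := mul_mem_polyPiece a (d - a) g x hg hx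
    rwa [add_sub_cancel] at this

lemma finrank_idealPiece_span_singleton {g : MvPolynomial (Fin n) K} {a : ℕ}
    (hg : g.IsHomogeneous a) (h0 : g ≠ 0) (d : ℤ) :
    Module.finrank K (idealPiece (Ideal.span {g}) d) = Module.finrank K (polyPiece K n (d - a)) := by
  rw [idealPiece_span_singleton hg, ← (Submodule.equivMapOfInjective (LinearMap.mulLeft K g)
    (mul_right_injective₀ h0) _).finrank_eq]

end

/-! ### Principality from the Hilbert function of I -/

open MvPolynomial

section

variable {K : Type u} [Field K]

lemma bwdDiff_nonneg_of_le_hdepth_ideal {n k : ℕ} {I : Ideal (MvPolynomial (Fin n) K)}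
    (h : (k : ℕ∞) ≤ hdepth K n (idealGrading I)) (d : ℤ) :
    0 ≤ bwdDiff^[k] (fun d => (Module.finrank K (idealPiece I d) : ℤ)) d := by
  have := iterate_bwdDiff_nonneg_of_le_hdepth h d
  simpa only [hilbertSeries_idealGrading] using this

lemma finrank_idealPiece_le {k : ℕ} (I : Ideal (MvPolynomial (Fin (k + 1)) K)) (d : ℤ) :
    (Module.finrank K (idealPiece I d) : ℤ) ≤ monomialCount k d := by
  rw [← finrank_polyPiece (K := K)]
  exact_mod_cast Submodule.finrank_mono (idealPiece_le I d)

lemma idealPiece_of_neg {n : ℕ} (I : Ideal (MvPolynomial (Fin n) K)) {d : ℤ} (h : d < 0) :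
    idealPiece I d = ⊥ := by
  rw [eq_bot_iff, ← polyPiece_of_neg (K := K) (n := n) h]
  exact idealPiece_le I d

/-- A homogeneous ideal whose Hilbert function has nonnegative `n`-th difference is principal. -/
lemma isPrincipal_of_iterate_bwdDiff_nonneg {k : ℕ} {I : Ideal (MvPolynomial (Fin (k + 1)) K)}
    (hI : ∀ f ∈ I, ∀ d, polyProj K (k + 1) d f ∈ I) (hbot : I ≠ ⊥)
    (h : ∀ d, 0 ≤ bwdDiff^[k + 1] (fun d => (Module.finrank K (idealPiece I d) : ℤ)) d) :
    I.IsPrincipal := by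
  classical
  set H : ℤ → ℤ := fun d => (Module.finrank K (idealPiece I d) : ℤ) with hH
  have hex : ∃ a : ℕ, idealPiece I a ≠ ⊥ := by
    by_contra! hall
    refine hbot (eq_bot_iff.mpr fun f hf => ?_)
    have : ∀ d, polyProj K (k + 1) d f ∈ (⊥ : Ideal (MvPolynomial (Fin (k + 1)) K)) := by
      intro d
      have h1 : polyProj K (k + 1) d f ∈ idealPiece I d := ⟨hI f hf d, polyProj_mem d f⟩
      rcases lt_or_ge d 0 with hd | hd
      · rwa [idealPiece_of_neg I hd] at h1
      · obtain ⟨m, rfl⟩ := Int.eq_ofNat_of_zero_le hd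
        rwa [hall m] at h1
    exact mem_of_forall_polyProj_mem this
  obtain ⟨a, ha, hmin⟩ : ∃ a : ℕ, idealPiece I a ≠ ⊥ ∧ ∀ d : ℤ, d < a → idealPiece I d = ⊥ := by
    refine ⟨Nat.find hex, Nat.find_spec hex, fun d hd => ?_⟩
    rcases lt_or_ge d 0 with hd0 | hd0
    · exact idealPiece_of_neg I hd0
    · obtain ⟨m, rfl⟩ := Int.eq_ofNat_of_zero_le hd0
      simpa using Nat.find_min hex (by exact_mod_cast hd : m < Nat.find hex)
  have hH0 : ∀ d : ℤ, d < a → H d = 0 := fun d hd => by simp [hH, hmin d hd]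
  have hHa : 1 ≤ H a := by
    have : Module.finrank K (idealPiece I a) ≠ 0 := by rwa [Ne, Submodule.finrank_eq_zero]
    simp only [hH]
    omega
  have hB0 : ∀ d : ℤ, d < a → shift a (monomialCount k) d = 0 := fun d hd =>
    monomialCount_of_neg k (by omega)
  have hΔ : ∀ d, bwdDiff^[k + 1] (shift a (monomialCount k)) d = if d = a then 1 else 0 := by
    intro d
    rw [iterate_bwdDiff_shift, shift, iterate_succ_bwdDiff_monomialCount]
    simp only [sub_eq_zero]
  have hF0 : ∀ d ≤ (a : ℤ) - 1, (H - shift a (monomialCount k)) d = 0 := fun d hd => by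
    rw [Pi.sub_apply, hH0 d (by omega), hB0 d (by omega), sub_zero]
  -- At the initial degree a the difference of `H` equals H(a) ≥ 1, so one copy of S(-a) can be
  -- removed.
  have hF : ∀ d, 0 ≤ bwdDiff^[k + 1] (H - shift a (monomialCount k)) d := by
    intro d
    rw [iterate_bwdDiff_sub, Pi.sub_apply, hΔ]
    split_ifs with hd
    · rw [hd, iterate_bwdDiff_apply_of_lt (k + 1) hH0]
      omega
    · rw [sub_zero]; exact h d
  -- If nothing is left, `H` is the Hilbert function of (g) for any nonzero g in I_a, and (g) ⊆ I is
  -- an equality.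
  by_cases hzero : ∀ e, bwdDiff^[k + 1] (H - shift a (monomialCount k)) e = 0
  · obtain ⟨g, hg, hg0⟩ := Submodule.exists_mem_ne_zero_of_ne_bot ha
    have hle : Ideal.span {g} ≤ I := (Ideal.span_singleton_le_iff_mem I).mpr hg.1
    have hIle := le_of_finrank_idealPiece_le hle hI fun d => by
      rw [finrank_idealPiece_span_singleton hg.2 hg0]
      have h1 := nonneg_of_iterate_bwdDiff_nonneg (f := shift a (monomialCount k) - H) (k + 1)
        (a := a - 1) (fun d hd => by
          rw [Pi.sub_apply, hH0 d (by omega), hB0 d (by omega), sub_zero]) (fun e => by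
          have := hzero e
          rw [iterate_bwdDiff_sub, Pi.sub_apply] at this ⊢
          omega) d
      have h2 := finrank_polyPiece (K := K) k (d - a)
      simp only [Pi.sub_apply, shift, hH] at h1
      omega
    exact ⟨⟨g, le_antisymm hIle hle⟩⟩
  · exfalso
    push Not at hzero
    obtain ⟨e, he⟩ := hzero
    have hae : (a : ℤ) ≤ e := by
      by_contra hlt
      exact he (iterate_bwdDiff_eq_zero_of_le (k + 1) hF0 e (by omega))
    -- A second copy, shifted by e, can be removed as well. Then H(d) ≥ h(d-a) + h(d-e) ≥ 2h(d-e),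
    -- which exceeds h(d) for some d, against H ≤ h.
    have hge : ∀ d, 0 ≤ (H - shift a (monomialCount k) - shift e (monomialCount k)) d := by
      refine nonneg_of_iterate_bwdDiff_nonneg (k + 1) (a := a - 1) (fun d hd => ?_) fun d => ?_
      · rw [Pi.sub_apply, hF0 d hd, shift, monomialCount_of_neg k (by omega), sub_zero]
      · rw [iterate_bwdDiff_sub, Pi.sub_apply, iterate_bwdDiff_shift, shift,
          iterate_succ_bwdDiff_monomialCount]
        have := hF d
        split_ifs with hd
        · obtain rfl : d = e := by omega
          omega
        · omega
    obtain ⟨c, rfl⟩ := Int.eq_ofNat_of_zero_le (show 0 ≤ e by omega)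
    obtain ⟨d, hd⟩ := eventually_mul_sub_lt_monomialCount k 2 c
    have h1 := hd d le_rfl
    have h2 := hge d
    have h3 := finrank_idealPiece_le I d
    have h4 := monomialCount_mono k (show d - c ≤ d - a by omega)
    simp only [Pi.sub_apply, shift, hH] at h2
    push_cast at h1
    linarith

/-- A polynomial divisible by no variable is relatively prime to every monomial. -/
lemma isRelPrime_monomial {n : ℕ} {g : MvPolynomial (Fin n) K} (hg : ∀ i, ¬ X i ∣ g)
    (α : Fin n →₀ ℕ) : IsRelPrime (monomial α (1 : K)) g := by
  rw [monomial_eq, C_1, one_mul, Finsupp.prod]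
  refine IsRelPrime.prod_left fun i _ => IsRelPrime.pow_left ?_
  exact (X_prime.irreducible.isRelPrime_iff_not_dvd).mpr (hg i)

/-- If a homogeneous ideal `I` contains `u v` and `u g` with `v`, `g` relatively prime of degree
`D`, its Hilbert function is at least that of `u (v, g)`. -/
lemma finrank_idealPiece_ge {k : ℕ} {I : Ideal (MvPolynomial (Fin (k + 1)) K)}
    {u v g : MvPolynomial (Fin (k + 1)) K} {a D : ℕ} (hu : u.IsHomogeneous a)
    (hv : v.IsHomogeneous D) (hg : g.IsHomogeneous D) (hu0 : u ≠ 0) (hv0 : v ≠ 0) (hg0 : g ≠ 0)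
    (hvg : IsRelPrime v g) (h1 : u * v ∈ I) (h2 : u * g ∈ I) (d : ℤ) :
    2 * monomialCount k (d - a - D) - monomialCount k (d - a - 2 * D) ≤
      Module.finrank K (idealPiece I d) := by
  have e1 := finrank_idealPiece_span_singleton (hu.mul hv) (mul_ne_zero hu0 hv0) d
  have e2 := finrank_idealPiece_span_singleton (hu.mul hg) (mul_ne_zero hu0 hg0) d
  have e3 := finrank_idealPiece_span_singleton (hu.mul (hv.mul hg))
    (mul_ne_zero hu0 (mul_ne_zero hv0 hg0)) d
  have hsup : idealPiece (Ideal.span {u * v}) d ⊔ idealPiece (Ideal.span {u * g}) d ≤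
      idealPiece I d :=
    sup_le (idealPiece_mono ((Ideal.span_singleton_le_iff_mem I).mpr h1) d)
      (idealPiece_mono ((Ideal.span_singleton_le_iff_mem I).mpr h2) d)
  -- Coprimality of v and g puts common multiples of uv and ug in (uvg), which bounds the correction
  -- term in the dimension formula for the sum.
  have hinf : idealPiece (Ideal.span {u * v}) d ⊓ idealPiece (Ideal.span {u * g}) d ≤
      idealPiece (Ideal.span {u * (v * g)}) d := by
    rintro f ⟨⟨hf1, hf⟩, ⟨hf2, -⟩⟩
    refine ⟨?_, hf⟩
    obtain ⟨x, rfl⟩ := Ideal.mem_span_singleton.mp hf1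
    obtain ⟨y, hy⟩ := Ideal.mem_span_singleton.mp hf2
    rw [mul_assoc, mul_assoc] at hy
    have hgx : g ∣ v * x := ⟨y, mul_left_cancel₀ hu0 hy⟩
    refine Ideal.mem_span_singleton.mpr ?_
    rw [mul_assoc]
    exact mul_dvd_mul_left u (hvg.mul_dvd (dvd_mul_right v x) hgx)
  have e4 := Submodule.finrank_sup_add_finrank_inf_eq (idealPiece (Ideal.span {u * v}) d)
    (idealPiece (Ideal.span {u * g}) d)
  have e5 := Submodule.finrank_mono hsup
  have e6 := Submodule.finrank_mono hinf
  have e7 := finrank_polyPiece (K := K) k (d - a - D)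
  have e8 := finrank_polyPiece (K := K) k (d - a - 2 * D)
  rw [show d - ((a + D : ℕ) : ℤ) = d - a - D by push_cast; ring] at e1 e2
  rw [show d - ((a + (D + D) : ℕ) : ℤ) = d - a - 2 * D by push_cast; ring] at e3
  omega

end

/-! ### Principality from the Hilbert function of S/I -/

open MvPolynomial

section

variable {K : Type u} [Field K]

/-- Monomials `w i` of a common degree, the `i`-th of which does not involve `x_i`, lying in the
quotient of a monomial ideal by the greatest common divisor `x^α` of its elements. -/
lemma exists_family_avoiding {k : ℕ} {A : Set (Fin (k + 2) →₀ ℕ)} {α : Fin (k + 2) →₀ ℕ}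
    (hle : ∀ β ∈ A, α ≤ β) (hmin : ∀ i, ∃ β ∈ A, β i = α i) :
    ∃ (D : ℕ) (w : Fin (k + 2) → Fin (k + 2) →₀ ℕ), (∀ i, (w i).degree = D) ∧ (∀ i, w i i = 0) ∧
      ∀ i, ∃ β ∈ A, β ≤ α + w i := by
  choose β hβA hβ using hmin
  -- Each β i - α is padded to the common degree by a power of a variable other than x_i; this needs
  -- two variables.
  choose j hj using fun i : Fin (k + 2) => exists_ne i
  refine ⟨∑ i, (β i - α).degree, fun i => (β i - α) +
    Finsupp.single (j i) (∑ i, (β i - α).degree - (β i - α).degree), fun i => ?_, fun i => ?_,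
    fun i => ⟨β i, hβA i, ?_⟩⟩
  · have := Finset.single_le_sum (f := fun i => (β i - α).degree) (fun _ _ => Nat.zero_le _)
      (Finset.mem_univ i)
    rw [map_add, Finsupp.degree_single]
    omega
  · simp [hβ, hj]
  · rw [← add_assoc, add_tsub_cancel_of_le (hle _ (hβA i))]
    exact le_self_add

/-- A monomial ideal such that the Hilbert function of `S/I` has nonnegative `(n-1)`-st difference
is principal. -/
lemma IsMonomialIdeal.isPrincipal_of_iterate_bwdDiff_nonneg {k : ℕ}
    {I : Ideal (MvPolynomial (Fin (k + 2)) K)} (hI : IsMonomialIdeal I) (hbot : I ≠ ⊥)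
    (h : ∀ d, 0 ≤ bwdDiff^[k + 1]
      (monomialCount (k + 1) - fun d => (Module.finrank K (idealPiece I d) : ℤ)) d) :
    I.IsPrincipal := by
  classical
  obtain ⟨A, hA⟩ := hI
  have hmonI : ∀ β ∈ A, ∀ γ, β ≤ γ → monomial γ (1 : K) ∈ I := by
    intro β hβ γ hγ
    rw [hA, mem_ideal_span_monomial_image]
    intro δ hδ
    rw [Finset.mem_singleton.mp (support_monomial_subset hδ)]
    exact ⟨β, hβ, hγ⟩
  obtain ⟨β₀, hβ₀⟩ : A.Nonempty := by
    rw [Set.nonempty_iff_ne_empty]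
    rintro rfl
    exact hbot (by rw [hA]; simp)
  let α : Fin (k + 2) →₀ ℕ := Finsupp.equivFunOnFinite.symm fun i => sInf ((fun β => β i) '' A)
  have hle : ∀ β ∈ A, α ≤ β := fun β hβ i => Nat.sInf_le ⟨β, hβ, rfl⟩
  have hmin : ∀ i, ∃ β ∈ A, β i = α i := fun i =>
    Nat.sInf_mem (s := (fun β : Fin (k + 2) →₀ ℕ => β i) '' A) ⟨_, β₀, hβ₀, rfl⟩
  set u : MvPolynomial (Fin (k + 2)) K := monomial α 1 with hu
  have huhom : u.IsHomogeneous α.degree := isHomogeneous_monomial 1 rfl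
  have hu0 : u ≠ 0 := by simp [hu]
  have hIu : I ≤ Ideal.span {u} := by
    rw [hA, Ideal.span_le]
    rintro _ ⟨β, hβ, rfl⟩
    exact Ideal.mem_span_singleton.mpr (monomial_one_dvd_monomial_one.mpr (hle β hβ))
  by_cases huI : u ∈ I
  · exact ⟨⟨u, le_antisymm hIu ((Ideal.span_singleton_le_iff_mem I).mpr huI)⟩⟩
  exfalso
  obtain ⟨a, ha⟩ : ∃ a, a = α.degree := ⟨_, rfl⟩
  rw [← ha] at huhom
  have hrank := finrank_idealPiece_span_singleton huhom hu0
  set H : ℤ → ℤ := fun d => (Module.finrank K (idealPiece I d) : ℤ) with hH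
  -- In degree a the ideal (u) is the line spanned by u, and u ∉ I.
  have hH0 : ∀ d ≤ (a : ℤ), H d = 0 := by
    intro d hd
    have h1 := idealPiece_mono hIu d
    have h2 := hrank d
    rcases hd.lt_or_eq with hd | rfl
    · rw [polyPiece_of_neg (by omega), finrank_bot] at h2
      have := Submodule.finrank_mono h1
      simp only [hH]
      omega
    · by_contra hne
      have h3 : (Module.finrank K (polyPiece K (k + 2) 0) : ℤ) = 1 := by
        rw [finrank_polyPiece]; simp [monomialCount]
      rw [sub_self] at h2
      have h4 : idealPiece I a = idealPiece (Ideal.span {u}) a := by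
        refine Submodule.eq_of_le_of_finrank_le h1 ?_
        simp only [hH] at hne
        omega
      have h5 : u ∈ idealPiece I a := h4 ▸ ⟨Ideal.mem_span_singleton_self u, huhom⟩
      exact huI h5.1
  -- For d ≥ 0 the (k+1)-st difference of `monomialCount (k + 1)` is 1, so that of `H` is at most 1;
  -- as `H` vanishes up to degree a, summation compares it with S(-a-1).
  have hupper : ∀ d, 0 ≤ (shift (a + 1) (monomialCount (k + 1)) - H) d := by
    have hG0 : ∀ d ≤ (a : ℤ), (shift (a + 1) (monomialCount (k + 1)) - H) d = 0 := fun d hd => by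
      rw [Pi.sub_apply, hH0 d hd, shift, monomialCount_of_neg _ (by omega), sub_zero]
    refine nonneg_of_iterate_bwdDiff_nonneg (k + 1) hG0 fun d => ?_
    rcases le_or_gt d a with hd | hd
    · exact (iterate_bwdDiff_eq_zero_of_le (k + 1) hG0 d hd).ge
    · have h1 := h d
      rw [iterate_bwdDiff_sub, Pi.sub_apply, iterate_bwdDiff_monomialCount, monomialCount_zero,
        if_neg (by omega)] at h1
      rw [iterate_bwdDiff_sub, Pi.sub_apply, iterate_bwdDiff_shift, iterate_bwdDiff_monomialCount,
        shift, monomialCount_zero, if_neg (by omega)]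
      exact h1
  obtain ⟨D, w, hwD, hwi, hwA⟩ := exists_family_avoiding hle hmin
  have hmul : ∀ i, u * monomial (w i) 1 ∈ I := fun i => by
    obtain ⟨β, hβ, hβw⟩ := hwA i
    rw [hu, monomial_mul, one_mul]
    exact hmonI β hβ _ hβw
  -- Summing over the image counts repeated monomials once, so every coefficient is 1 in any
  -- characteristic. The term `w i` prevents x_i from dividing `g`.
  set g : MvPolynomial (Fin (k + 2)) K := ∑ γ ∈ Finset.univ.image w, monomial γ 1 with hg
  have hgX : ∀ i, ¬ X i ∣ g := by
    rintro i ⟨q, hq⟩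
    have h1 : coeff (w i) g = 1 := by
      rw [hg, coeff_sum, Finset.sum_eq_single (w i)]
      · rw [coeff_monomial, if_pos rfl]
      · intro γ _ hγ
        rw [coeff_monomial, if_neg hγ]
      · intro hn
        exact absurd (Finset.mem_image_of_mem w (Finset.mem_univ i)) hn
    rw [hq, coeff_X_mul', if_neg (by simp [hwi])] at h1
    exact zero_ne_one h1
  have hghom : g.IsHomogeneous D := by
    refine IsHomogeneous.sum _ _ _ fun γ hγ => ?_
    obtain ⟨i, -, rfl⟩ := Finset.mem_image.mp hγ
    exact isHomogeneous_monomial 1 (hwD i)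
  have hgI : u * g ∈ I := by
    rw [hg, Finset.mul_sum]
    refine I.sum_mem fun γ hγ => ?_
    obtain ⟨i, -, rfl⟩ := Finset.mem_image.mp hγ
    exact hmul i
  have hg0 : g ≠ 0 := fun h0 => hgX 0 (h0 ▸ dvd_zero _)
  have hlower := finrank_idealPiece_ge huhom (isHomogeneous_monomial 1 (hwD 0)) hghom hu0 (by simp)
    hg0 (isRelPrime_monomial hgX (w 0)) (hmul 0) hgI
  -- In degree d₀ + a the two bounds give h(d₀) - h(d₀-1) ≤ D (h_k(d₀) - h_k(d₀-2D)), with left side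
  -- h_k(d₀); the constants D and 2D contradict this.
  obtain ⟨d₀, hd₀⟩ := eventually_mul_sub_lt_monomialCount k D (2 * D)
  have h1 := hd₀ d₀ le_rfl
  have h2 := hupper (d₀ + a)
  have h3 := hlower (d₀ + a)
  have h4 := monomialCount_second_difference_le k D d₀
  have h5 := congrFun (bwdDiff_monomialCount_succ k) d₀
  rw [add_sub_cancel_right] at h3
  simp only [Pi.sub_apply, shift, hH, bwdDiff] at h2 h5
  rw [show d₀ + a - ((a : ℤ) + 1) = d₀ - 1 by ring] at h2
  linarith

end

/-! ### Regular sequences of variables and principal ideals -/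

open MvPolynomial

section

variable {K : Type u} [Field K] {n : ℕ}

lemma isGrading_quotientGrading {I : Ideal (MvPolynomial (Fin n) K)}
    (hI : ∀ f ∈ I, ∀ d, polyProj K n d f ∈ I) : IsGrading K n (quotientGrading I) where
  isInternal := by
    have hπ : Function.Surjective (I.mkQ.restrictScalars K) := Submodule.mkQ_surjective I
    have hker : ∀ f, I.mkQ.restrictScalars K f = 0 ↔ f ∈ I := fun f =>
      Submodule.Quotient.mk_eq_zero I
    choose q hq using fun d => exists_linearMap_descend (I.mkQ.restrictScalars K) hπ
      (polyProj K n d) fun f hf => (hker _).mpr (hI f ((hker f).mp hf) d)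
    refine isInternal_of_proj q ?_ ?_ ?_
    · rintro d _ ⟨f, hf, rfl⟩
      rw [hq, polyProj_of_mem d f hf]
    · rintro d e hed _ ⟨f, hf, rfl⟩
      rw [hq, polyProj_of_mem_ne d e hed f hf, map_zero]
    · simp only [quotientGrading]
      rw [← Submodule.map_iSup, iSup_polyPiece, Submodule.map_top, LinearMap.range_eq_top]
      exact hπ
  smul_mem := by
    rintro i d f _ hf ⟨x, hx, rfl⟩
    exact ⟨f * x, mul_mem_polyPiece i d f x hf hx, rfl⟩

/-- A generator that divides x_i x^α and does not involve x_i already divides x^α. -/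
lemma mem_span_monomial_of_X_mul_mem {B : Set (Fin n →₀ ℕ)} {i : Fin n} (hB : ∀ β ∈ B, β i = 0)
    {f : MvPolynomial (Fin n) K}
    (h : X i * f ∈ Ideal.span ((fun s => monomial s (1 : K)) '' B)) :
    f ∈ Ideal.span ((fun s => monomial s (1 : K)) '' B) := by
  rw [mem_ideal_span_monomial_image] at h ⊢
  intro α hα
  obtain ⟨β, hβ, hle⟩ := h (Finsupp.single i 1 + α) (by
    rw [mem_support_iff, coeff_X_mul]
    exact mem_support_iff.mp hα)
  refine ⟨β, hβ, fun j => ?_⟩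
  have := hle j
  by_cases hij : i = j
  · rw [← hij, hB β hβ]; exact Nat.zero_le _
  · simpa [Finsupp.single_apply, hij] using this

/-- The exponents of the variables in a list. -/
def varExponents (L : List (Fin n)) : Set (Fin n →₀ ℕ) := {β | ∃ i ∈ L, β = Finsupp.single i 1}

/-- Killing variables in S/J leaves the quotient by another monomial ideal, so regularity becomes
divisibility of exponents. -/
lemma mk_mem_ofList_smul_top_iff (A : Set (Fin n →₀ ℕ)) (L : List (Fin n))
    (f : MvPolynomial (Fin n) K) :
    (Submodule.Quotient.mk f : MvPolynomial (Fin n) K ⧸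
        Ideal.span ((fun s => monomial s (1 : K)) '' A)) ∈
      (Ideal.ofList (L.map (X : Fin n → MvPolynomial (Fin n) K)) • ⊤ : Submodule (MvPolynomial (Fin n) K) (MvPolynomial (Fin n) K ⧸
        Ideal.span ((fun s => monomial s (1 : K)) '' A))) ↔
      f ∈ Ideal.span ((fun s => monomial s (1 : K)) '' (A ∪ varExponents L)) := by
  set J := Ideal.span ((fun s => monomial s (1 : K)) '' A) with hJ
  have h1 : (Ideal.ofList (L.map (X : Fin n → MvPolynomial (Fin n) K)) • ⊤ : Submodule (MvPolynomial (Fin n) K) _) =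
      Submodule.map J.mkQ (Ideal.ofList (L.map (X : Fin n → MvPolynomial (Fin n) K))) := by
    rw [← Submodule.range_mkQ J, ← Submodule.map_top, ← Submodule.map_smul'', smul_eq_mul,
      Ideal.mul_top]
  have h2 : Ideal.span ((fun s => monomial s (1 : K)) '' (A ∪ varExponents L)) =
      J ⊔ Ideal.ofList (L.map (X : Fin n → MvPolynomial (Fin n) K)) := by
    rw [Set.image_union, Ideal.span_union, ← hJ]
    congr 2
    ext f
    simp only [varExponents, Set.mem_image, Set.mem_ofPred_eq, List.mem_map]
    constructor
    · rintro ⟨_, ⟨i, hi, rfl⟩, rfl⟩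
      exact ⟨i, hi, rfl⟩
    · rintro ⟨i, hi, rfl⟩
      exact ⟨_, ⟨i, hi, rfl⟩, rfl⟩
  rw [h1, h2, ← Submodule.mkQ_apply, ← Submodule.mem_comap, Submodule.comap_map_mkQ]

/-- Distinct variables not occurring in the generators of a proper monomial ideal `J` form a regular
sequence on `S/J`. -/
lemma isRegular_map_X {A : Set (Fin n →₀ ℕ)} {L : List (Fin n)} (hL : L.Nodup)
    (hA : ∀ β ∈ A, ∀ i ∈ L, β i = 0) (h0 : 0 ∉ A) :
    RingTheory.Sequence.IsRegular (MvPolynomial (Fin n) K ⧸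
      Ideal.span ((fun s => monomial s (1 : K)) '' A)) (L.map (X : Fin n → MvPolynomial (Fin n) K)) where
  regular_mod_prev i hi := by
    rw [isSMulRegular_quotient_iff_mem_of_smul_mem]
    intro x hx
    obtain ⟨f, rfl⟩ := Submodule.Quotient.mk_surjective _ x
    rw [List.length_map] at hi
    rw [← List.map_take, ← Submodule.Quotient.mk_smul] at hx
    rw [← List.map_take]
    rw [mk_mem_ofList_smul_top_iff] at hx ⊢
    rw [List.getElem_map, smul_eq_mul] at hx
    refine mem_span_monomial_of_X_mul_mem ?_ hx
    rintro β (hβ | ⟨j, hj, rfl⟩)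
    · exact hA β hβ _ (List.getElem_mem hi)
    · rw [Finsupp.single_apply, if_neg]
      rintro rfl
      obtain ⟨m, hm, hm'⟩ := List.mem_take_iff_getElem.mp hj
      have := (List.Nodup.getElem_inj_iff hL).mp hm'
      omega
  top_ne_smul h := by
    have h1 : (Submodule.Quotient.mk 1 : MvPolynomial (Fin n) K ⧸
        Ideal.span ((fun s => monomial s (1 : K)) '' A)) ∈
        (Ideal.ofList (L.map (X : Fin n → MvPolynomial (Fin n) K)) • ⊤ : Submodule (MvPolynomial (Fin n) K) _) := h ▸ Submodule.mem_top
    rw [mk_mem_ofList_smul_top_iff, mem_ideal_span_monomial_image] at h1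
    obtain ⟨β, hβ, hle⟩ := h1 0 (by simp)
    obtain rfl : β = 0 := le_antisymm hle (zero_le)
    rcases hβ with hβ | ⟨i, -, hi⟩
    · exact h0 hβ
    · simpa using DFunLike.congr_fun hi i

lemma X_mem_irrelevantIdeal_of_mem_map {L : List (Fin n)} :
    ∀ f ∈ L.map (X : Fin n → MvPolynomial (Fin n) K), f ∈ irrelevantIdeal K n := by
  intro f hf
  obtain ⟨i, -, rfl⟩ := List.mem_map.mp hf
  exact Ideal.subset_span ⟨i, rfl⟩

/-- The generator of a principal monomial ideal is homogeneous. -/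
lemma IsMonomialIdeal.exists_homogeneous_generator {I : Ideal (MvPolynomial (Fin n) K)}
    (hI : IsMonomialIdeal I) (hbot : I ≠ ⊥) (htop : I ≠ ⊤) (hp : I.IsPrincipal) :
    ∃ (a : ℕ) (g : MvPolynomial (Fin n) K), 0 < a ∧ g ≠ 0 ∧ g.IsHomogeneous a ∧
      I = Ideal.span {g} := by
  obtain ⟨A, hA⟩ := hI
  obtain ⟨β, hβ⟩ : A.Nonempty := by
    rw [Set.nonempty_iff_ne_empty]
    rintro rfl
    exact hbot (by rw [hA]; simp)
  obtain ⟨⟨g, hg⟩⟩ := hp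
  change I = Ideal.span {g} at hg
  have hmem : monomial β (1 : K) ∈ I := hA ▸ Ideal.subset_span ⟨β, hβ, rfl⟩
  rw [hg, Ideal.mem_span_singleton, dvd_monomial_one_iff_exists] at hmem
  obtain ⟨γ, c, -, hc, rfl⟩ := hmem
  refine ⟨γ.degree, _, ?_, ?_, isHomogeneous_monomial c rfl, hg⟩
  · rw [Nat.pos_iff_ne_zero]
    intro h0
    rw [Finsupp.degree_eq_zero_iff] at h0
    refine htop ?_
    rw [hg, Ideal.span_singleton_eq_top, h0]
    exact hc.map C
  · rw [Ne, monomial_eq_zero]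
    exact hc.ne_zero

end

section

variable {K : Type u} [Field K] {k a : ℕ} {g : MvPolynomial (Fin (k + 1)) K}

lemma hilbertSeries_idealGrading_span_singleton (hg : g.IsHomogeneous a) (h0 : g ≠ 0) :
    (fun d => (hilbertSeries K (idealGrading (Ideal.span {g})) d : ℤ)) =
      shift a (monomialCount k) := by
  funext d
  rw [hilbertSeries_idealGrading, finrank_idealPiece_span_singleton hg h0, finrank_polyPiece]
  rfl

lemma hilbertSeries_quotientGrading_span_singleton (hg : g.IsHomogeneous a) (h0 : g ≠ 0) :
    (fun d => (hilbertSeries K (quotientGrading (Ideal.span {g})) d : ℤ)) =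
      monomialCount k - shift a (monomialCount k) := by
  funext d
  rw [hilbertSeries_quotientGrading, finrank_idealPiece_span_singleton hg h0, finrank_polyPiece,
    finrank_polyPiece]
  rfl

/-- The (k+1)-st difference is the indicator of a, so the next one is -1 at a + 1. The bound is
attained by S(-a) with all its variables. -/
lemma hdepth_idealGrading_span_singleton (hg : g.IsHomogeneous a) (h0 : g ≠ 0) :
    hdepth K (k + 1) (idealGrading (Ideal.span {g})) = (k + 1 : ℕ) := by
  refine le_antisymm (hdepth_le_of_iterate_bwdDiff_neg (d := a + 1) ?_) ?_
  · rw [hilbertSeries_idealGrading_span_singleton hg h0, Function.iterate_succ_apply',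
      iterate_bwdDiff_shift, bwdDiff, shift, shift, iterate_succ_bwdDiff_monomialCount,
      iterate_succ_bwdDiff_monomialCount]
    simp
  · have hreg : RingTheory.Sequence.IsRegular (MvPolynomial (Fin (k + 1)) K)
        ((List.finRange (k + 1)).map (X : _ → MvPolynomial (Fin (k + 1)) K)) := by
      refine ((Submodule.quotEquivOfEqBot _ ?_).isRegular_congr _).mp
        (isRegular_map_X (K := K) (A := ∅) (List.nodup_finRange _) (by simp) (by simp))
      simp
    have h := le_hdepth (ℳ := idealGrading (Ideal.span {g}))
      (isGrading_polyPiece (K := K) (n := k + 1) a) (by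
        funext d
        rw [hilbertSeries_idealGrading, finrank_idealPiece_span_singleton hg h0]
        rfl) _ X_mem_irrelevantIdeal_of_mem_map hreg
    simpa using h

/-- The (k+1)-st difference is 1 at 0 and -1 at a, which are distinct because a > 0. The bound is
attained by S/(x_0^a) rather than S/(g): the other k variables are visibly regular on it. -/
lemma hdepth_quotientGrading_span_singleton (ha : 0 < a) (hg : g.IsHomogeneous a) (h0 : g ≠ 0) :
    hdepth K (k + 1) (quotientGrading (Ideal.span {g})) = k := by
  refine le_antisymm (hdepth_le_of_iterate_bwdDiff_neg (d := a) ?_) ?_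
  · rw [hilbertSeries_quotientGrading_span_singleton hg h0, iterate_bwdDiff_sub, Pi.sub_apply,
      iterate_bwdDiff_shift, shift, iterate_succ_bwdDiff_monomialCount,
      iterate_succ_bwdDiff_monomialCount, if_neg (by omega), if_pos (by omega)]
    norm_num
  · set J : Ideal (MvPolynomial (Fin (k + 1)) K) :=
      Ideal.span ((fun s => monomial s (1 : K)) '' {Finsupp.single 0 a}) with hJ
    have hJs : J = Ideal.span {monomial (Finsupp.single 0 a) 1} := by rw [hJ, Set.image_singleton]
    have hreg := isRegular_map_X (K := K) (A := {Finsupp.single (0 : Fin (k + 1)) a})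
      (L := (List.finRange k).map Fin.succ)
      ((List.nodup_finRange k).map (Fin.succ_injective k)) (by
        intro β hβ i hi
        obtain ⟨j, -, rfl⟩ := List.mem_map.mp hi
        rw [Set.mem_singleton_iff.mp hβ]
        simp) (by
        rw [Set.mem_singleton_iff, eq_comm, Finsupp.single_eq_zero]
        omega)
    have h := le_hdepth (ℳ := quotientGrading (Ideal.span {g}))
      (isGrading_quotientGrading (I := J) fun f hf d => IsMonomialIdeal.polyProj_mem ⟨_, hJ⟩ hf d)
      (by
        have e1 := hilbertSeries_quotientGrading_span_singleton hg h0
        have e2 := hilbertSeries_quotientGrading_span_singleton (K := K) (k := k) (a := a)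
          (g := monomial (Finsupp.single 0 a) 1) (isHomogeneous_monomial 1 (by simp)) (by simp)
        rw [← hJs, ← e1] at e2
        funext d
        exact_mod_cast congrFun e2 d) _ X_mem_irrelevantIdeal_of_mem_map hreg
    simpa using h

end

end HilbertDepth

theorem theorem2p2 {K : Type u} [Field K] (n : ℕ) (I : Ideal (MvPolynomial (Fin n) K))
    (hI : HilbertDepth.IsMonomialIdeal I) (hbot : I ≠ ⊥) (htop : I ≠ ⊤) :
    List.TFAE [
      I.IsPrincipal,
      HilbertDepth.hdepth K n (HilbertDepth.idealGrading I) = (n : ℕ∞),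
      HilbertDepth.hdepth K n (HilbertDepth.quotientGrading I) + 1 = (n : ℕ∞)] := by
  open HilbertDepth in
  -- With no variables S = K, and a nonzero monomial ideal is everything.
  obtain _ | k := n
  · exfalso
    obtain ⟨A, hA⟩ := hI
    obtain ⟨β, hβ⟩ : A.Nonempty := by
      rw [Set.nonempty_iff_ne_empty]
      rintro rfl
      exact hbot (by rw [hA]; simp)
    refine htop ((Ideal.eq_top_iff_one I).mpr ?_)
    have h1 : MvPolynomial.monomial β (1 : K) ∈ I := hA ▸ Ideal.subset_span ⟨β, hβ, rfl⟩
    rwa [Subsingleton.elim β 0] at h1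
  tfae_have 1 → 2 := by
    intro hp
    obtain ⟨a, g, -, h0, hg, rfl⟩ := hI.exists_homogeneous_generator hbot htop hp
    exact hdepth_idealGrading_span_singleton hg h0
  tfae_have 1 → 3 := by
    intro hp
    obtain ⟨a, g, ha, h0, hg, rfl⟩ := hI.exists_homogeneous_generator hbot htop hp
    rw [hdepth_quotientGrading_span_singleton ha hg h0]
    push_cast
    rfl
  tfae_have 2 → 1 := fun h => isPrincipal_of_iterate_bwdDiff_nonneg
    (fun f hf d => hI.polyProj_mem hf d) hbot (bwdDiff_nonneg_of_le_hdepth_ideal h.ge)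
  tfae_have 3 → 1 := by
    intro h
    have h' : hdepth K (k + 1) (quotientGrading I) = k := by
      push_cast at h
      exact WithTop.add_right_cancel ENat.one_ne_top h
    -- In one variable S is a principal ideal ring; the growth argument needs at least two.
    obtain _ | k := k
    · have : IsPrincipalIdealRing (MvPolynomial (Fin 1) K) :=
        .of_surjective (MvPolynomial.uniqueAlgEquiv K (Fin 1)).symm
          (MvPolynomial.uniqueAlgEquiv K (Fin 1)).symm.surjective
      exact IsPrincipalIdealRing.principal I
    · refine hI.isPrincipal_of_iterate_bwdDiff_nonneg hbot fun d => ?_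
      have := iterate_bwdDiff_nonneg_of_le_hdepth h'.ge d
      simp only [hilbertSeries_quotientGrading, finrank_polyPiece] at this
      exact this
  tfae_finish
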